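/- Let $n\ge 2$, and for $s\in\mathbb R$, $1\le p\le\infty$ let $W^{s,p}(\mathbb R^n)$ be the Sobolev space with norm $\|f\|_{W^{s,p}}=\|(1+|D|^2)^{s/2}f\|_{L^p}$. Put $p=\frac{2(n+1)}{n-1}$ and $p'=\frac{2(n+1)}{n+3}$. Let $s=\frac1{n+1}$ if $n\ge 3$; if $n=2$ (so that $p=6$, $p'=\frac65$), fix $\varepsilon>0$ and let $s=\frac13-\varepsilon$. Let $X$ be the space of all distributions $W\in W^{-s,p'}_{loc}(\mathbb R^n)$ with $$\|W\|_X=\sup_{0\ne u\in C_0^\infty(\mathbb R^n)}\frac{\|Wu\|_{W^{-s,p'}}}{\|u\|_{W^{s,p}}}<\infty .$$ For an open set $D\subset\mathbb R^n$ let $X(D)$ be the space of restrictions to $D$ of elements of $X$, with the norm $$\|W\|_{X(D)}=\inf\{\|W'\|_X:\ W'\in X,\ W'=W \text{ on } D\},$$ where $W'=W$ on $D$ means that both distributions agree on all test functions supported in $D$. Then, for every $W\in X$, $$\lim_{\alpha\to 0^+}\|W\|_{X(B(0,\alpha))}=0 .$$ -/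

import Mathlib

open scoped ENNReal Topology SchwartzMap Distributions
open MeasureTheory TopologicalSpace

noncomputable section

namespace KochTataru

/-- `ℝⁿ` with its Euclidean norm. -/
abbrev Rn (n : ℕ) : Type := EuclideanSpace ℝ (Fin n)

/-- Complex-valued test functions `C₀^∞(ℝⁿ)`. -/
abbrev Test (n : ℕ) : Type := 𝓓((⊤ : Opens (Rn n)), ℂ)

/-- Complex distributions on `ℝⁿ`: continuous `ℂ`-linear functionals on `C₀^∞(ℝⁿ)`. -/
abbrev Distr (n : ℕ) : Type := Test n →L[ℂ] ℂ

/-- A test function, regarded as a Schwartz function. -/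
def Test.toSchwartz {n : ℕ} (u : Test n) : 𝓢(Rn n, ℂ) :=
  u.hasCompactSupport.toSchwartzMap u.contDiff

theorem Test.hasTemperateGrowth {n : ℕ} (u : Test n) :
    Function.HasTemperateGrowth (u : Rn n → ℂ) :=
  u.hasCompactSupport.hasTemperateGrowth u.contDiff

/-- The (compact) support of a test function. -/
def Test.supp {n : ℕ} (u : Test n) : Compacts (Rn n) :=
  ⟨tsupport (u : Rn n → ℂ), u.hasCompactSupport⟩

/-- For a test function `u`, the linear map `φ ↦ u φ` from Schwartz functions to the smooth
functions supported in `supp u`. -/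
def Test.mulLM {n : ℕ} (u : Test n) : 𝓢(Rn n, ℂ) →ₗ[ℂ] 𝓓_{u.supp}(Rn n, ℂ) where
  toFun φ := ContDiffMapSupportedIn.of_support_subset (f := fun x ↦ u x * φ x)
    (u.contDiff.mul (φ.smooth ⊤))
    ((Function.support_mul_subset_left _ _).trans (subset_tsupport _))
  map_add' φ ψ := by
    ext x
    change u x * (φ x + ψ x) = u x * φ x + u x * ψ x
    ring
  map_smul' c φ := by
    ext x
    change u x * (c * φ x) = c * (u x * φ x)
    ring

theorem Test.continuous_mulLM {n : ℕ} (u : Test n) : Continuous u.mulLM := by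
  refine WithSeminorms.continuous_of_continuous_comp
    (ContDiffMapSupportedIn.withSeminorms ℂ (Rn n) ℂ ⊤ u.supp) u.mulLM fun i ↦ ?_
  refine Seminorm.continuous_of_le
    (q := (SchwartzMap.seminorm ℂ 0 i).comp
      (SchwartzMap.smulLeftCLM ℂ (u : Rn n → ℂ) : 𝓢(Rn n, ℂ) →ₗ[ℂ] 𝓢(Rn n, ℂ))) ?_ ?_
  · exact ((schwartz_withSeminorms ℂ (Rn n) ℂ).continuous_seminorm (0, i)).comp
      (SchwartzMap.smulLeftCLM ℂ (u : Rn n → ℂ)).continuous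
  · intro φ
    change ContDiffMapSupportedIn.seminorm ℂ (Rn n) ℂ ⊤ u.supp i (u.mulLM φ) ≤
      SchwartzMap.seminorm ℂ 0 i (SchwartzMap.smulLeftCLM ℂ (u : Rn n → ℂ) φ)
    rw [ContDiffMapSupportedIn.seminorm_top_le_iff ℂ (apply_nonneg _ _)]
    intro x _
    have h : ((u.mulLM φ : 𝓓_{u.supp}(Rn n, ℂ)) : Rn n → ℂ) =
        SchwartzMap.smulLeftCLM ℂ (u : Rn n → ℂ) φ := by
      rw [SchwartzMap.smulLeftCLM_apply u.hasTemperateGrowth]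
      rfl
    rw [h]
    simpa using SchwartzMap.le_seminorm ℂ 0 i
      (SchwartzMap.smulLeftCLM ℂ (u : Rn n → ℂ) φ) x

/-- For a test function `u`, the continuous linear map `φ ↦ u φ` from Schwartz functions to
test functions. -/
def Test.mulCLM {n : ℕ} (u : Test n) : 𝓢(Rn n, ℂ) →L[ℂ] Test n :=
  (TestFunction.ofSupportedInCLM ℂ (Ω := (⊤ : Opens (Rn n))) (K := u.supp)
    (Set.subset_univ _)).comp ⟨u.mulLM, u.continuous_mulLM⟩

theorem Test.mulCLM_apply {n : ℕ} (u : Test n) (φ : 𝓢(Rn n, ℂ)) (x : Rn n) :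
    u.mulCLM φ x = u x * φ x := rfl

/-- The product `W u` of a distribution `W` and a test function `u`, as a tempered distribution:
`⟨W u, φ⟩ = ⟨W, u φ⟩`. -/
def Distr.mulTest {n : ℕ} (W : Distr n) (u : Test n) : 𝓢'(Rn n, ℂ) :=
  ContinuousLinearMap.toPointwiseConvergenceCLM _ _ _ _ (W.comp u.mulCLM)

theorem Distr.mulTest_apply {n : ℕ} (W : Distr n) (u : Test n) (φ : 𝓢(Rn n, ℂ)) :
    W.mulTest u φ = W (u.mulCLM φ) := rfl

/-- The symbol of `(1 + |D|²)^{s/2}`, `D = -i∂`, in the frequency variable `ξ` of the Fourier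
transform `∫ e^{-2πi x·ξ} f(x) dx`; `D` corresponds to `2πξ`. -/
def japSymbol (n : ℕ) (s : ℝ) (ξ : Rn n) : ℂ :=
  (((1 + ‖(2 * Real.pi) • ξ‖ ^ 2) ^ (s / 2) : ℝ) : ℂ)

theorem japSymbol_hasTemperateGrowth (n : ℕ) (s : ℝ) :
    Function.HasTemperateGrowth (japSymbol n s) := by
  have h₁ := Function.hasTemperateGrowth_one_add_norm_sq_rpow (Rn n) (s / 2)
  have h₂ : Function.HasTemperateGrowth (fun ξ : Rn n ↦ (2 * Real.pi) • ξ) :=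
    ((2 * Real.pi) • ContinuousLinearMap.id ℝ (Rn n)).hasTemperateGrowth
  exact Function.HasTemperateGrowth.comp Function.Complex.hasTemperateGrowth_ofReal (h₁.comp h₂)

/-- The operator `(1 + |D|²)^{s/2}` on tempered distributions. -/
def jap (n : ℕ) (s : ℝ) : 𝓢'(Rn n, ℂ) →L[ℂ] 𝓢'(Rn n, ℂ) :=
  TemperedDistribution.fourierMultiplierCLM ℂ (japSymbol n s)

/-- The norm `‖T‖_{W^{s,p}} = ‖(1 + |D|²)^{s/2} T‖_{L^p}` (for `1 ≤ p ≤ ∞`) of a tempered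
distribution; it is `∞` if `(1 + |D|²)^{s/2} T` is not represented by an `L^p` function. -/
def sobolevNorm {n : ℕ} (s : ℝ) (p : ℝ≥0∞) (T : 𝓢'(Rn n, ℂ)) : ℝ≥0∞ :=
  ⨅ (f : Rn n → ℂ) (_ : MemLp f p volume)
    (_ : ∀ φ : 𝓢(Rn n, ℂ), jap n s T φ = ∫ x, φ x * f x), eLpNorm f p volume

/-- `W ∈ W^{s,p}_loc`: all localizations of `W` by test functions belong to `W^{s,p}`. -/
def MemSobolevLoc {n : ℕ} (s : ℝ) (p : ℝ≥0∞) (W : Distr n) : Prop :=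
  ∀ u : Test n, sobolevNorm s p (W.mulTest u) < ∞

/-- The smoothness exponent: `1/(n+1)` for `n ≥ 3`, and `1/3 - ε` for `n = 2`. -/
def expS (n : ℕ) (ε : ℝ) : ℝ := if n = 2 then 1 / 3 - ε else 1 / ((n : ℝ) + 1)

/-- The exponent `2(n+1)/(n-1)`, which is `6` for `n = 2`. -/
def expP (n : ℕ) : ℝ≥0∞ := ENNReal.ofReal (2 * ((n : ℝ) + 1) / ((n : ℝ) - 1))

/-- The dual exponent `2(n+1)/(n+3)`, which is `6/5` for `n = 2`. -/
def expQ (n : ℕ) : ℝ≥0∞ := ENNReal.ofReal (2 * ((n : ℝ) + 1) / ((n : ℝ) + 3))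

/-- The multiplier norm
`‖W‖_X = sup_{0 ≠ u ∈ C₀^∞} ‖W u‖_{W^{-s,2(n+1)/(n+3)}} / ‖u‖_{W^{s,2(n+1)/(n-1)}}`. -/
def normX {n : ℕ} (ε : ℝ) (W : Distr n) : ℝ≥0∞ :=
  ⨆ (u : Test n) (_ : u ≠ 0),
    sobolevNorm (-expS n ε) (expQ n) (W.mulTest u) /
      sobolevNorm (expS n ε) (expP n) (u.toSchwartz : 𝓢'(Rn n, ℂ))

/-- The space `X`: the distributions in `W^{-s,2(n+1)/(n+3)}_loc` with finite multiplier norm. -/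
def MemX {n : ℕ} (ε : ℝ) (W : Distr n) : Prop :=
  MemSobolevLoc (-expS n ε) (expQ n) W ∧ normX ε W < ∞

/-- `W' = W` on the open set `D` (that is, `1_D W' = 1_D W`): the two distributions agree on
all test functions supported in `D`. -/
def AgreeOn {n : ℕ} (D : Set (Rn n)) (W' W : Distr n) : Prop :=
  ∀ φ : Test n, tsupport (φ : Rn n → ℂ) ⊆ D → W' φ = W φ

/-- The norm of (the restriction of) `W` in `X(D)`, `D` open: since `X(D)` is the image of `X`
under restriction to `D`, this is the infimum of the `X`-norms of all `W' ∈ X` that have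
the same restriction to `D` as `W`. -/
def normXOn {n : ℕ} (ε : ℝ) (D : Set (Rn n)) (W : Distr n) : ℝ≥0∞ :=
  ⨅ (W' : Distr n) (_ : MemX ε W') (_ : AgreeOn D W' W), normX ε W'

end KochTataru

end

/-! Write J^s for (1 + |D|²)^{s/2}. By duality between W^{-s,p'} and W^{s,p}, the norm of `W` in X
is the norm of the bilinear form (u, v) ↦ W(uv) on W^{s,p}. Let η be the limit, as r → 0, of the
norm of this form on functions supported in B(0, r). The heart of the matter is that η = 0
(`exists_ball_bilinear_le`), and the reason is p > 2. If η > 0, take a normalized pair u₁, v₁ with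
W(u₁v₁) close to η, and then a normalized pair u₂, v₂ with W(u₂v₂) close to η, supported so near the
origin that J^s u₁ and J^s u₂ live on almost disjoint sets, and likewise J^s v₁ and J^s v₂. The
functions u₁ ± u₂ and v₁ ± v₂ then have norm at most about 2^{1/p}, and the parallelogram identity
W((u₁+u₂)(v₁+v₂)) + W((u₁-u₂)(v₁-v₂)) = 2W(u₁v₁) + 2W(u₂v₂) gives, up to small errors, 4η ≤
2·2^{2/p}η, which is absurd since 2^{2/p} < 2.

To return to X(B(0, α)), the extension χ²W is used, with χ a cutoff at scale α: one factor χ goes to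
each argument of the form (`tendsto_normXOn`). This needs multiplication by χ to be bounded on
W^{s,p} uniformly in the scale.

The two analytic inputs, `UniformCutoffs` and `Concentrates`, both follow for 0 < s < 1 and sp < n
from a single commutator bound, `exists_eLpNorm_commutator_le`. Writing J^s as a superposition of
heat kernels bounds the commutator [J^s, g]u by the integral of |x-y|^{-s-n} |g(x)-g(y)| |u(y)|. If
|g(x)-g(y)| ≤ L|x-y|/|y| on the support of u, this is a Riesz potential of order 1-s of |u|/|y|,
which Hardy's inequality and its dual control; both come from Schur's test with power weights.

For n = 2 and large ε the exponent s is not positive. If s = 0 both inputs are trivial. If s < 0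
then W = 0: a test function is a product of two factors modulated in opposite directions, whose
norms tend to zero. -/

noncomputable section

namespace KochTataru

open FourierTransform

variable {n : ℕ}

/-! ### Bessel operators on Schwartz functions and Sobolev duality -/

/-- The operator `(1 + |D|²)^{s/2}` on Schwartz functions. -/
def japS (n : ℕ) (s : ℝ) : 𝓢(Rn n, ℂ) →L[ℂ] 𝓢(Rn n, ℂ) :=
  SchwartzMap.fourierMultiplierCLM ℂ (japSymbol n s)

theorem japSymbol_mul (s t : ℝ) : japSymbol n s * japSymbol n t = japSymbol n (s + t) := by
  ext ξ
  simp only [japSymbol, Pi.mul_apply]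
  rw [← Complex.ofReal_mul, ← Real.rpow_add (by positivity), add_div]

theorem japSymbol_zero : japSymbol n 0 = fun _ ↦ 1 := by
  ext ξ
  simp [japSymbol]

theorem japSymbol_neg (s : ℝ) (ξ : Rn n) : japSymbol n s (-ξ) = japSymbol n s ξ := by
  simp [japSymbol]

theorem japS_zero (u : 𝓢(Rn n, ℂ)) : japS n 0 u = u := by
  simp [japS, japSymbol_zero]

theorem japS_japS (s t : ℝ) (u : 𝓢(Rn n, ℂ)) : japS n s (japS n t u) = japS n (s + t) u := by
  rw [japS, japS, SchwartzMap.fourierMultiplierCLM_fourierMultiplierCLM_apply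
    (japSymbol_hasTemperateGrowth n s) (japSymbol_hasTemperateGrowth n t), japSymbol_mul]
  rfl

theorem japS_neg_japS (s : ℝ) (u : 𝓢(Rn n, ℂ)) : japS n (-s) (japS n s u) = u := by
  rw [japS_japS, neg_add_cancel, japS_zero]

theorem japS_japS_neg (s : ℝ) (u : 𝓢(Rn n, ℂ)) : japS n s (japS n (-s) u) = u := by
  rw [japS_japS, add_neg_cancel, japS_zero]

/-- On distributions the multiplier acts by transposition, which puts the two Fourier transforms in
the opposite order. The symbol is even, so the order is immaterial and the operator is symmetric. -/
theorem fourier_smulLeft_fourierInv (s : ℝ) (u : 𝓢(Rn n, ℂ)) :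
    𝓕 (SchwartzMap.smulLeftCLM ℂ (japSymbol n s) (𝓕⁻ u)) = japS n s u := by
  ext x
  rw [japS, SchwartzMap.fourierMultiplierCLM_apply]
  rw [SchwartzMap.fourierInv_coe, SchwartzMap.fourier_coe, Real.fourierInv_eq_fourier_comp_neg]
  refine congrArg (fun h : Rn n → ℂ ↦ 𝓕 h x) (funext fun y ↦ ?_)
  change _ = SchwartzMap.smulLeftCLM ℂ (japSymbol n s) (𝓕 u) (-y)
  rw [SchwartzMap.smulLeftCLM_apply_apply (japSymbol_hasTemperateGrowth n s),
    SchwartzMap.smulLeftCLM_apply_apply (japSymbol_hasTemperateGrowth n s), japSymbol_neg,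
    SchwartzMap.fourierInv_coe, SchwartzMap.fourier_coe, Real.fourierInv_eq_fourier_neg]

theorem jap_apply (s : ℝ) (T : 𝓢'(Rn n, ℂ)) (φ : 𝓢(Rn n, ℂ)) :
    jap n s T φ = T (japS n s φ) := by
  rw [jap, TemperedDistribution.fourierMultiplierCLM_apply_apply, fourier_smulLeft_fourierInv]

/-- The norm of a Schwartz function in `W^{s,p}`. -/
def sN (s : ℝ) (p : ℝ≥0∞) (u : 𝓢(Rn n, ℂ)) : ℝ≥0∞ := eLpNorm (japS n s u) p volume

theorem sN_lt_top (s : ℝ) (p : ℝ≥0∞) (u : 𝓢(Rn n, ℂ)) : sN s p u < ∞ :=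
  ((japS n s u).memLp p volume).2

theorem sN_smul (s : ℝ) (p : ℝ≥0∞) (c : ℂ) (u : 𝓢(Rn n, ℂ)) :
    sN s p (c • u) = ‖c‖ₑ * sN s p u := by
  rw [sN, map_smul]
  exact eLpNorm_const_smul _ _ _ _

theorem jap_toTempered (s : ℝ) (u φ : 𝓢(Rn n, ℂ)) :
    jap n s (u : 𝓢'(Rn n, ℂ)) φ = ∫ x, φ x * japS n s u x := by
  rw [jap, TemperedDistribution.fourierMultiplierCLM_toTemperedDistributionCLM_eq
    (japSymbol_hasTemperateGrowth n s)]
  rfl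

theorem ae_eq_of_forall_schwartz {f g : Rn n → ℂ} (hf : LocallyIntegrable f volume)
    (hg : LocallyIntegrable g volume)
    (h : ∀ φ : 𝓢(Rn n, ℂ), ∫ x, φ x * f x = ∫ x, φ x * g x) : f =ᵐ[volume] g := by
  refine ae_eq_of_integral_contDiff_smul_eq hf hg fun χ hχ hc ↦ ?_
  have h₁ : HasCompactSupport (Complex.ofRealCLM ∘ χ) := hc.comp_left rfl
  have h₂ := Complex.ofRealCLM.contDiff.comp hχ
  simpa using h (h₁.toSchwartzMap h₂)

theorem sobolevNorm_toTempered {p : ℝ≥0∞} (hp : 1 ≤ p) (s : ℝ) (u : 𝓢(Rn n, ℂ)) :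
    sobolevNorm s p (u : 𝓢'(Rn n, ℂ)) = sN s p u := by
  apply le_antisymm
  · exact iInf_le_of_le (japS n s u) (iInf_le_of_le ((japS n s u).memLp p volume)
      (iInf_le_of_le (jap_toTempered s u) le_rfl))
  · refine le_iInf fun f ↦ le_iInf fun hf ↦ le_iInf fun h ↦ ?_
    refine (eLpNorm_congr_ae (ae_eq_of_forall_schwartz
      (((japS n s u).memLp p volume).locallyIntegrable hp) (hf.locallyIntegrable hp) ?_)).le
    intro φ
    rw [← h, jap_toTempered]

/-- Duality between `W^{-s,q}` and `W^{s,p}`. -/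
theorem enorm_apply_le_sobolevNorm {p q : ℝ≥0∞} [q.HolderConjugate p] (s : ℝ)
    (T : 𝓢'(Rn n, ℂ)) (v : 𝓢(Rn n, ℂ)) :
    ‖T v‖ₑ ≤ sobolevNorm (-s) q T * sN s p v := by
  -- The factor can be moved inside the infimum defining the Sobolev norm only when it is finite and
  -- nonzero.
  rcases eq_or_ne (sN s p v) 0 with h0 | h0
  · have : japS n s v = 0 := by
      have := (eLpNorm_eq_zero_iff (japS n s v).continuous.aestronglyMeasurable
        (ENNReal.HolderConjugate.ne_zero p q)).1 h0
      ext x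
      exact congrFun ((Continuous.ae_eq_iff_eq volume (japS n s v).continuous
        continuous_zero).1 this) x
    rw [← japS_neg_japS s v, this]
    simp
  rw [sobolevNorm, ENNReal.iInf_mul_of_ne h0 (sN_lt_top s p v).ne]
  refine le_iInf fun f ↦ ?_
  rw [ENNReal.iInf_mul_of_ne h0 (sN_lt_top s p v).ne]
  refine le_iInf fun hf ↦ ?_
  rw [ENNReal.iInf_mul_of_ne h0 (sN_lt_top s p v).ne]
  refine le_iInf fun h ↦ ?_
  have := h (japS n s v)
  rw [jap_apply, japS_neg_japS] at this
  rw [this]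
  refine (enorm_integral_le_lintegral_enorm _).trans ?_
  rw [← eLpNorm_one_eq_lintegral_enorm]
  have := eLpNorm_smul_le_mul_eLpNorm (r := 1) (f := f) (φ := japS n s v) (p := p) (q := q)
    (μ := volume)
    hf.1 (japS n s v).continuous.aestronglyMeasurable
  rw [mul_comm]
  exact this

/-- Converse of Hölder's inequality, tested on Schwartz functions. -/
theorem eLpNorm_le_of_forall_schwartz {p q : ℝ≥0∞} [p.HolderConjugate q] (hp : p ≠ ∞)
    (hq : q ≠ ∞) {f : Rn n → ℂ} (hf : MemLp f q volume) {M : ℝ≥0∞}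
    (h : ∀ φ : 𝓢(Rn n, ℂ), ‖∫ x, φ x * f x‖ₑ ≤ M * eLpNorm φ p volume) :
    eLpNorm f q volume ≤ M := by
  rcases eq_or_ne M ∞ with rfl | hM
  · exact le_top
  have hp1 : 1 ≤ p := ENNReal.HolderConjugate.one_le p q
  have hq1 : 1 ≤ q := ENNReal.HolderConjugate.one_le q p
  have : Fact (1 ≤ p) := ⟨hp1⟩
  have : Fact (1 ≤ q) := ⟨hq1⟩
  have hall : ∀ g : Lp ℂ p (volume : Measure (Rn n)),
      ‖∫ x, g x * f x‖ ≤ M.toReal * ‖g‖ := by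
    -- Pairing with f is continuous on L^p, so the bound extends from Schwartz functions to L^p by
    -- density, which needs p finite.
    let Λ := ((ContinuousLinearMap.mul ℂ ℂ).lpPairing (volume : Measure (Rn n)) p q).flip
      (hf.toLp f)
    have hΛ : ∀ g : Lp ℂ p (volume : Measure (Rn n)), Λ g = ∫ x, g x * f x := by
      intro g
      change (ContinuousLinearMap.mul ℂ ℂ).lpPairing (volume : Measure (Rn n)) p q g (hf.toLp f) = _
      rw [ContinuousLinearMap.lpPairing_eq_integral]
      refine integral_congr_ae ?_
      filter_upwards [hf.coeFn_toLp] with x hx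
      simp [hx]
    intro g
    rw [← hΛ]
    refine (SchwartzMap.denseRange_toLpCLM (F := ℂ) (E := Rn n) (μ := volume) hp).induction_on
      (p := fun g ↦ ‖Λ g‖ ≤ M.toReal * ‖g‖) g ?_ ?_
    · exact isClosed_le (by fun_prop) (by fun_prop)
    · intro φ
      rw [hΛ, SchwartzMap.toLpCLM_apply, SchwartzMap.norm_toLp, ← ENNReal.toReal_mul,
        ← toReal_enorm]
      refine ENNReal.toReal_mono (ENNReal.mul_ne_top hM (φ.memLp p volume).2.ne) ?_
      refine le_trans (le_of_eq ?_) (h φ)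
      congr 1
      refine integral_congr_ae ?_
      filter_upwards [φ.coeFn_toLp p volume] with x hx
      rw [hx]
  set t := q.toReal with ht
  have hconj : p.toReal.HolderConjugate t :=
    ENNReal.HolderConjugate.toReal_of_ne_top hp hq
  have ht1 : 0 < t - 1 := hconj.symm.sub_one_pos
  have hqt : q = ENNReal.ofReal t := (ENNReal.ofReal_toReal hq).symm
  -- The extremal function of Hölder's inequality: gf = |f|^t and |g| = |f|^{t-1}.
  let g : Rn n → ℂ := fun x ↦ (starRingEnd ℂ) (f x) * ((‖f x‖ ^ (t - 2) : ℝ) : ℂ)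
  have hgm : AEStronglyMeasurable g volume := by
    refine (Complex.continuous_conj.comp_aestronglyMeasurable hf.1).mul ?_
    exact (Complex.measurable_ofReal.comp_aemeasurable
      (hf.1.aemeasurable.norm.pow_const (t - 2))).aestronglyMeasurable
  have hgn : ∀ x, ‖g x‖ = ‖f x‖ ^ (t - 1) := by
    intro x
    simp only [g, norm_mul, RCLike.norm_conj, Complex.norm_real]
    rw [Real.norm_of_nonneg (by positivity)]
    rcases (norm_nonneg (f x)).eq_or_lt with h0 | h0
    · rw [← h0, zero_mul, Real.zero_rpow ht1.ne']
    · rw [← Real.rpow_one_add' h0.le (by linarith)]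
      congr 1
      ring
  have hgN : eLpNorm g p volume = eLpNorm f q volume ^ (t - 1) := by
    rw [← eLpNorm_norm, funext hgn, eLpNorm_norm_rpow _ ht1]
    congr 2
    rw [hqt, ← ENNReal.ofReal_toReal hp, ← ENNReal.ofReal_mul ENNReal.toReal_nonneg, mul_comm,
      hconj.symm.sub_one_mul_conj]
  have hg : MemLp g p volume :=
    ⟨hgm, by rw [hgN]; exact ENNReal.rpow_lt_top_of_nonneg ht1.le hf.2.ne⟩
  have hgf : ∀ x, g x * f x = ((‖f x‖ ^ t : ℝ) : ℂ) := by
    intro x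
    simp only [g]
    rw [mul_right_comm, mul_comm ((starRingEnd ℂ) (f x)), Complex.mul_conj, ← Complex.ofReal_mul,
      Complex.normSq_eq_norm_sq]
    congr 1
    rcases (norm_nonneg (f x)).eq_or_lt with h0 | h0
    · simp [← h0, Real.zero_rpow (by linarith : t ≠ 0)]
    · rw [← Real.rpow_natCast, ← Real.rpow_add h0]
      congr 1
      push_cast
      ring
  have key := hall (hg.toLp g)
  have e1 : ∫ x, (hg.toLp g) x * f x = ((∫ x, ‖f x‖ ^ t : ℝ) : ℂ) := by
    rw [← integral_complex_ofReal]
    refine integral_congr_ae ?_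
    filter_upwards [hg.coeFn_toLp] with x hx
    rw [hx, hgf]
  have hA := hf.eLpNorm_eq_integral_rpow_norm (ENNReal.HolderConjugate.ne_zero q p) hq
  rw [e1, Complex.norm_real, Real.norm_of_nonneg (by positivity), Lp.norm_toLp, hgN,
    ← ENNReal.toReal_rpow] at key
  set A := (eLpNorm f q volume).toReal with hAdef
  have hA0 : 0 ≤ A := ENNReal.toReal_nonneg
  have hI : ∫ x, ‖f x‖ ^ t = A ^ t := by
    have : A = (∫ x, ‖f x‖ ^ t) ^ t⁻¹ := by
      rw [hAdef, hA, ENNReal.toReal_ofReal (by positivity)]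
    rw [this, ← Real.rpow_mul (by positivity), inv_mul_cancel₀ (by linarith), Real.rpow_one]
  rw [hI] at key
  rw [← ENNReal.toReal_le_toReal hf.2.ne hM]
  change A ≤ _
  rcases hA0.eq_or_lt with h0 | h0
  · rw [← h0]; exact ENNReal.toReal_nonneg
  · have : A ^ t = A * A ^ (t - 1) := by
      rw [← Real.rpow_one_add' hA0 (by linarith)]
      congr 1
      ring
    rw [this] at key
    exact le_of_mul_le_mul_right key (Real.rpow_pos_of_pos h0 _)

/-- Duality only estimates the norm of a function already known to lie in L^q, whence the hypothesis
`hT`; for elements of X it is provided by membership in the local Sobolev space. -/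
theorem sobolevNorm_le_of_pairing {p q : ℝ≥0∞} [p.HolderConjugate q] (hp : p ≠ ∞)
    (hq : q ≠ ∞) {s : ℝ} {T : 𝓢'(Rn n, ℂ)} (hT : sobolevNorm (-s) q T < ∞) {M : ℝ≥0∞}
    (h : ∀ v : 𝓢(Rn n, ℂ), ‖T v‖ₑ ≤ M * sN s p v) : sobolevNorm (-s) q T ≤ M := by
  simp only [sobolevNorm, iInf_lt_iff] at hT
  obtain ⟨f, hf, hfT, -⟩ := hT
  refine iInf_le_of_le f (iInf_le_of_le hf (iInf_le_of_le hfT ?_))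
  refine eLpNorm_le_of_forall_schwartz hp hq hf fun φ ↦ ?_
  rw [← hfT, jap_apply]
  refine (h _).trans_eq ?_
  rw [sN, japS_japS_neg]

/-! ### Products with test functions and the bilinear form W(uv) -/

theorem Test.toSchwartz_apply (u : Test n) (x : Rn n) : u.toSchwartz x = u x := rfl

theorem Test.toSchwartz_add (u v : Test n) :
    (u + v).toSchwartz = u.toSchwartz + v.toSchwartz := by
  ext x; rfl

theorem Test.toSchwartz_neg (u : Test n) : (-u).toSchwartz = -u.toSchwartz := by
  ext x; rfl

theorem Test.toSchwartz_smul (c : ℂ) (u : Test n) :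
    (c • u).toSchwartz = c • u.toSchwartz := by
  ext x; rfl

theorem continuous_toSchwartz_ofSupportedIn (K : Compacts (Rn n))
    (hK : (K : Set (Rn n)) ⊆ (⊤ : Opens (Rn n))) :
    Continuous fun f : 𝓓_{K}(Rn n, ℂ) ↦ Test.toSchwartz (TestFunction.ofSupportedIn hK f) := by
  obtain ⟨R, hR⟩ := K.isCompact.isBounded.exists_norm_le
  let Λ : 𝓓_{K}(Rn n, ℂ) →ₗ[ℂ] 𝓢(Rn n, ℂ) :=
    { toFun := fun f ↦ Test.toSchwartz (TestFunction.ofSupportedIn hK f)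
      map_add' := fun f g ↦ by ext x; rfl
      map_smul' := fun c f ↦ by ext x; rfl }
  change Continuous Λ
  refine WithSeminorms.continuous_of_continuous_comp (schwartz_withSeminorms ℂ (Rn n) ℂ) Λ
    fun ⟨k, l⟩ ↦ ?_
  refine Seminorm.continuous_of_le
    (q := (|R| ^ k).toNNReal • ContDiffMapSupportedIn.seminorm ℂ (Rn n) ℂ ⊤ K l)
    ?_ ?_
  · have h := (ContDiffMapSupportedIn.withSeminorms ℂ (Rn n) ℂ ⊤ K).continuous_seminorm l
    exact continuous_const.mul h
  · intro f
    change SchwartzMap.seminorm ℂ k l (Λ f) ≤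
      ((|R| ^ k).toNNReal : ℝ) * ContDiffMapSupportedIn.seminorm ℂ (Rn n) ℂ ⊤ K l f
    rw [Real.coe_toNNReal _ (by positivity)]
    refine SchwartzMap.seminorm_le_bound ℂ k l _ (by positivity) fun x ↦ ?_
    change ‖x‖ ^ k * ‖iteratedFDeriv ℝ l f x‖ ≤ _
    by_cases hx : x ∈ K
    · gcongr
      · exact (hR x hx).trans (le_abs_self R)
      · exact ContDiffMapSupportedIn.norm_iteratedFDeriv_apply_le_seminorm_top ℂ
    · have : iteratedFDeriv ℝ l f x = 0 := by
        have h1 := (support_iteratedFDeriv_subset (𝕜 := ℝ) (f := (f : Rn n → ℂ)) l)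
        by_contra h
        exact hx (f.tsupport_subset (h1 h))
      rw [this, norm_zero, mul_zero]
      positivity

/-- The inclusion of test functions into Schwartz functions. -/
def Test.toSchwartzCLM (n : ℕ) : Test n →L[ℂ] 𝓢(Rn n, ℂ) :=
  TestFunction.mkCLM ℂ Test.toSchwartz Test.toSchwartz_add Test.toSchwartz_smul
    continuous_toSchwartz_ofSupportedIn

/-- The product of two test functions. -/
def Test.mul (χ u : Test n) : Test n := χ.mulCLM u.toSchwartz

theorem Test.mul_apply (χ u : Test n) (x : Rn n) : χ.mul u x = χ x * u x := rfl

/-- The product of a test function and a distribution. -/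
def Distr.cutoff (W : Distr n) (χ : Test n) : Distr n :=
  (W.comp χ.mulCLM).comp (Test.toSchwartzCLM n)

theorem Distr.cutoff_apply (W : Distr n) (χ φ : Test n) : W.cutoff χ φ = W (χ.mul φ) := rfl

theorem Distr.cutoff_mulTest (W : Distr n) (χ u : Test n) :
    (W.cutoff χ).mulTest u = W.mulTest (χ.mul u) := by
  ext φ
  rw [Distr.mulTest_apply, Distr.mulTest_apply, Distr.cutoff_apply]
  congr 1
  ext x
  rw [Test.mul_apply, Test.mulCLM_apply, Test.mulCLM_apply, Test.mul_apply, mul_assoc]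

theorem holderConjugate_exp (hn : 2 ≤ n) : (expP n).HolderConjugate (expQ n) := by
  refine Real.HolderConjugate.ennrealOfReal ?_
  have h : (2 : ℝ) ≤ n := by exact_mod_cast hn
  rw [Real.holderConjugate_iff]
  constructor
  · rw [lt_div_iff₀ (by linarith)]; linarith
  · field_simp
    ring

theorem expP_ne_top : expP n ≠ ∞ := ENNReal.ofReal_ne_top

theorem expQ_ne_top : expQ n ≠ ∞ := ENNReal.ofReal_ne_top

theorem MemX.exists_bound (hn : 2 ≤ n) {ε : ℝ} {W : Distr n} (hW : MemX ε W) :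
    ∃ M : ℝ≥0∞, M < ∞ ∧ ∀ (u : Test n) (v : 𝓢(Rn n, ℂ)), ‖W (u.mulCLM v)‖ₑ ≤
      M * sN (expS n ε) (expP n) u.toSchwartz * sN (expS n ε) (expP n) v := by
  have := holderConjugate_exp hn
  have hp1 : 1 ≤ expP n := ENNReal.HolderConjugate.one_le (expP n) (expQ n)
  refine ⟨normX ε W, hW.2, fun u v ↦ ?_⟩
  rcases eq_or_ne u 0 with rfl | hu
  · have : (0 : Test n).mulCLM v = 0 := by
      ext x
      rw [Test.mulCLM_apply]
      simp
    rw [this]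
    simp
  have h1 : sobolevNorm (-expS n ε) (expQ n) (W.mulTest u) /
      sobolevNorm (expS n ε) (expP n) (u.toSchwartz : 𝓢'(Rn n, ℂ)) ≤ normX ε W :=
    le_iSup₂_of_le (f := fun (u : Test n) (_ : u ≠ 0) ↦
      sobolevNorm (-expS n ε) (expQ n) (W.mulTest u) /
      sobolevNorm (expS n ε) (expP n) (u.toSchwartz : 𝓢'(Rn n, ℂ))) u hu le_rfl
  rw [sobolevNorm_toTempered hp1, ENNReal.div_le_iff_le_mul (Or.inr hW.2.ne)
    (Or.inl (sN_lt_top _ _ _).ne)] at h1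
  refine (enorm_apply_le_sobolevNorm (p := expP n) (q := expQ n) (expS n ε) (W.mulTest u) v).trans
    ?_
  gcongr

/-- Converse to `MemX.exists_bound` for the distribution χW. Since χu is again a test function, χWu
has finite negative Sobolev norm, and the pairing bound controls it. -/
theorem normX_cutoff_le (hn : 2 ≤ n) {ε : ℝ} {W : Distr n} (hW : MemX ε W) (χ : Test n)
    {M : ℝ≥0∞} (h : ∀ (u : Test n) (v : 𝓢(Rn n, ℂ)), ‖W ((χ.mul u).mulCLM v)‖ₑ ≤
      M * sN (expS n ε) (expP n) u.toSchwartz * sN (expS n ε) (expP n) v) :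
    normX ε (W.cutoff χ) ≤ M := by
  have := holderConjugate_exp hn
  have hp1 : 1 ≤ expP n := ENNReal.HolderConjugate.one_le (expP n) (expQ n)
  refine iSup₂_le fun u _ ↦ ?_
  rw [sobolevNorm_toTempered hp1]
  refine ENNReal.div_le_of_le_mul ?_
  rw [Distr.cutoff_mulTest]
  exact sobolevNorm_le_of_pairing expP_ne_top expQ_ne_top (hW.1 _) fun v ↦ h u v

theorem MemX.cutoff {ε : ℝ} {W : Distr n} (hW : MemX ε W) (χ : Test n)
    (h : normX ε (W.cutoff χ) < ∞) : MemX ε (W.cutoff χ) :=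
  ⟨fun u ↦ by rw [Distr.cutoff_mulTest]; exact hW.1 _, h⟩

/-! ### Almost disjoint functions and the parallelogram argument -/

/-- Functions concentrated on complementary sets add up in `L^p` like functions with disjoint
supports. -/
theorem eLpNorm_add_le_of_concentrated {p : ℝ≥0∞} (hp : 1 ≤ p) (hp' : p ≠ ∞) {f g : Rn n → ℂ}
    (hf : AEStronglyMeasurable f volume) (hg : AEStronglyMeasurable g volume)
    {B : Set (Rn n)} (hB : MeasurableSet B) {τ : ℝ≥0∞} (hf1 : eLpNorm f p volume ≤ 1)
    (hg1 : eLpNorm g p volume ≤ 1) (hfB : eLpNorm (B.indicator f) p volume ≤ τ)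
    (hgB : eLpNorm (Bᶜ.indicator g) p volume ≤ τ) :
    eLpNorm (f + g) p volume ≤ 2 ^ (1 / p.toReal) + 2 * τ := by
  have hp0 : p ≠ 0 := (zero_lt_one.trans_le hp).ne'
  have hpr : 0 < p.toReal := ENNReal.toReal_pos hp0 hp'
  -- The first bracket holds the main parts, whose supports are disjoint; the second holds the two
  -- tails, each of size at most τ.
  have hdec : f + g = (Bᶜ.indicator f + B.indicator g) + (B.indicator f + Bᶜ.indicator g) := by
    ext x
    by_cases hx : x ∈ B <;> simp [hx, add_comm]
  have hmain : eLpNorm (Bᶜ.indicator f + B.indicator g) p volume ≤ 2 ^ (1 / p.toReal) := by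
    rw [eLpNorm_eq_lintegral_rpow_enorm_toReal hp0 hp']
    refine ENNReal.rpow_le_rpow ?_ (by positivity)
    have h1 : ∀ {h : Rn n → ℂ}, eLpNorm h p volume ≤ 1 → ∫⁻ x, ‖h x‖ₑ ^ p.toReal ≤ 1 := by
      intro h hh
      rw [eLpNorm_eq_lintegral_rpow_enorm_toReal hp0 hp', one_div,
        ENNReal.rpow_inv_le_iff hpr, ENNReal.one_rpow] at hh
      exact hh
    rw [← lintegral_add_compl _ hB]
    refine (add_le_add ?_ ?_).trans_eq one_add_one_eq_two
    · refine le_trans ?_ (h1 hg1)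
      refine le_trans (le_of_eq ?_) (setLIntegral_le_lintegral B _)
      refine setLIntegral_congr_fun hB fun x hx ↦ ?_
      simp [hx]
    · refine le_trans ?_ (h1 hf1)
      refine le_trans (le_of_eq ?_) (setLIntegral_le_lintegral Bᶜ _)
      refine setLIntegral_congr_fun hB.compl fun x hx ↦ ?_
      have : x ∉ B := hx
      simp [this]
  rw [hdec]
  refine (eLpNorm_add_le ((hf.indicator hB.compl).add (hg.indicator hB))
    ((hf.indicator hB).add (hg.indicator hB.compl)) hp).trans ?_
  gcongr
  refine (eLpNorm_add_le (hf.indicator hB) (hg.indicator hB.compl) hp).trans ?_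
  rw [two_mul]
  gcongr

/-- Absolute continuity of the integral, since small balls have small measure. -/
theorem exists_eLpNorm_indicator_ball_le (hn : 2 ≤ n) {p : ℝ≥0∞} (hp : 1 ≤ p) (hp' : p ≠ ∞)
    {f : Rn n → ℂ} (hf : MemLp f p volume) {τ : ℝ} (hτ : 0 < τ) :
    ∃ ρ : ℝ, 0 < ρ ∧ eLpNorm ((Metric.ball 0 ρ).indicator f) p volume ≤ ENNReal.ofReal τ := by
  obtain ⟨δ, hδ, h⟩ := hf.eLpNorm_indicator_le hp hp' hτ
  set V := volume (Metric.ball (0 : Rn n) 1) with hV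
  have hlim : Filter.Tendsto (fun ρ : ℝ ↦ ENNReal.ofReal (ρ ^ n) * V) (𝓝[>] 0) (𝓝 0) := by
    have h1 : Filter.Tendsto (fun ρ : ℝ ↦ ENNReal.ofReal (ρ ^ n)) (𝓝[>] 0) (𝓝 0) := by
      have : Continuous fun ρ : ℝ ↦ ENNReal.ofReal (ρ ^ n) :=
        ENNReal.continuous_ofReal.comp (continuous_pow n)
      have := this.tendsto 0
      rw [zero_pow (by omega), ENNReal.ofReal_zero] at this
      exact this.mono_left nhdsWithin_le_nhds
    have := ENNReal.Tendsto.mul_const (b := V) h1 (Or.inr measure_ball_lt_top.ne)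
    rwa [zero_mul] at this
  obtain ⟨ρ, hρ1, hρ0⟩ := ((hlim.eventually (Iic_mem_nhds
    (ENNReal.ofReal_pos.2 hδ))).and self_mem_nhdsWithin).exists
  refine ⟨ρ, hρ0, h _ measurableSet_ball ?_⟩
  have : Nonempty (Fin n) := ⟨⟨0, by omega⟩⟩
  rw [Measure.addHaar_ball _ _ (le_of_lt hρ0), finrank_euclideanSpace_fin]
  exact hρ1

theorem Test.mul_add (u v w : Test n) : u.mul (v + w) = u.mul v + u.mul w := by
  ext x
  change u x * (v x + w x) = u x * v x + u x * w x
  ring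

theorem Test.add_mul (u v w : Test n) : (u + v).mul w = u.mul w + v.mul w := by
  ext x
  change (u x + v x) * w x = u x * w x + v x * w x
  ring

theorem Test.neg_mul (u v : Test n) : (-u).mul v = -u.mul v := by
  ext x
  change (-u x) * v x = -(u x * v x)
  ring

theorem Test.mul_neg (u v : Test n) : u.mul (-v) = -u.mul v := by
  ext x
  change u x * (-v x) = -(u x * v x)
  ring

theorem Test.smul_mul_smul (c d : ℂ) (u v : Test n) :
    (c • u).mul (d • v) = (c * d) • u.mul v := by
  ext x
  change (c * u x) * (d * v x) = (c * d) * (u x * v x)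
  ring

theorem parallelogram_apply (W : Distr n) (u₁ u₂ v₁ v₂ : Test n) :
    W ((u₁ + u₂).mul (v₁ + v₂)) + W ((u₁ + -u₂).mul (v₁ + -v₂)) =
      2 * (W (u₁.mul v₁) + W (u₂.mul v₂)) := by
  simp only [Test.mul_add, Test.add_mul, Test.neg_mul, Test.mul_neg, map_add, map_neg]
  ring

/-- A `W^{s,p}` function supported near the origin has its `s`-th derivative concentrated near
the origin. -/
def Concentrates (n : ℕ) (s : ℝ) (p : ℝ≥0∞) : Prop :=
  ∀ ρ : ℝ, 0 < ρ → ∀ τ : ℝ, 0 < τ → ∃ r : ℝ, 0 < r ∧ ∀ u : Test n,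
    tsupport (u : Rn n → ℂ) ⊆ Metric.ball 0 r →
      eLpNorm ((Metric.ball (0 : Rn n) ρ)ᶜ.indicator (japS n s u.toSchwartz)) p volume ≤
        ENNReal.ofReal τ * sN s p u.toSchwartz

/-- First a ball is chosen on which J^s u is small, then a support radius for v so small that J^s v
is small off that ball. -/
theorem Concentrates.exists_sN_add_le (hn : 2 ≤ n) {s : ℝ} {p : ℝ≥0∞} (hp : 1 ≤ p) (hp' : p ≠ ∞)
    (hB : Concentrates n s p) (u : Test n) (hu : sN s p u.toSchwartz ≤ 1) {τ : ℝ} (hτ : 0 < τ) :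
    ∃ r : ℝ, 0 < r ∧ ∀ v : Test n, tsupport (v : Rn n → ℂ) ⊆ Metric.ball 0 r →
      sN s p v.toSchwartz ≤ 1 →
        sN s p (u + v).toSchwartz ≤ 2 ^ (1 / p.toReal) + 2 * ENNReal.ofReal τ ∧
        sN s p (u + -v).toSchwartz ≤ 2 ^ (1 / p.toReal) + 2 * ENNReal.ofReal τ := by
  obtain ⟨ρ, hρ, hρu⟩ := exists_eLpNorm_indicator_ball_le hn hp hp'
    ((japS n s u.toSchwartz).memLp p volume) hτ
  obtain ⟨r, hr, hv⟩ := hB ρ hρ τ hτ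
  have key : ∀ v : Test n, tsupport (v : Rn n → ℂ) ⊆ Metric.ball 0 r →
      sN s p v.toSchwartz ≤ 1 →
        sN s p (u + v).toSchwartz ≤ 2 ^ (1 / p.toReal) + 2 * ENNReal.ofReal τ := by
    intro v hvs hv1
    rw [sN, Test.toSchwartz_add, map_add]
    refine eLpNorm_add_le_of_concentrated hp hp'
      (japS n s u.toSchwartz).continuous.aestronglyMeasurable
      (japS n s v.toSchwartz).continuous.aestronglyMeasurable measurableSet_ball hu hv1 hρu ?_
    refine (hv v hvs).trans ?_
    calc _ ≤ ENNReal.ofReal τ * 1 := by gcongr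
      _ = _ := mul_one _
  refine ⟨r, hr, fun v hvs hv1 ↦ ⟨key v hvs hv1, key (-v) ?_ ?_⟩⟩
  · have : ((-v : Test n) : Rn n → ℂ) = -(v : Rn n → ℂ) := rfl
    rw [this, tsupport_neg]
    exact hvs
  · rw [Test.toSchwartz_neg, ← neg_one_smul ℂ, sN_smul]
    simpa using hv1

theorem exists_normalized {s : ℝ} {p : ℝ≥0∞} {W : Distr n} {M : ℝ} {b r : ℝ} (hb : 0 ≤ b)
    (hW : ∀ u v : Test n, ‖W (u.mul v)‖ ≤
      M * (sN s p u.toSchwartz).toReal * (sN s p v.toSchwartz).toReal)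
    (h : ¬ ∀ u v : Test n, tsupport (u : Rn n → ℂ) ⊆ Metric.ball 0 r →
      tsupport (v : Rn n → ℂ) ⊆ Metric.ball 0 r → ‖W (u.mul v)‖ ≤
      b * (sN s p u.toSchwartz).toReal * (sN s p v.toSchwartz).toReal) :
    ∃ u v : Test n, tsupport (u : Rn n → ℂ) ⊆ Metric.ball 0 r ∧
      tsupport (v : Rn n → ℂ) ⊆ Metric.ball 0 r ∧ sN s p u.toSchwartz ≤ 1 ∧
      sN s p v.toSchwartz ≤ 1 ∧ ∃ a : ℝ, b < a ∧ W (u.mul v) = a := by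
  push Not at h
  obtain ⟨u, v, hu, hv, h⟩ := h
  set A := (sN s p u.toSchwartz).toReal with hA
  set B := (sN s p v.toSchwartz).toReal with hBdef
  have hA0 : 0 ≤ A := ENNReal.toReal_nonneg
  have hB0 : 0 ≤ B := ENNReal.toReal_nonneg
  have hz : 0 < ‖W (u.mul v)‖ := lt_of_le_of_lt (by positivity) h
  have hAB : A * B ≠ 0 := by
    intro h0
    have := hW u v
    rw [mul_assoc, h0, mul_zero] at this
    linarith
  have hAp : 0 < A := lt_of_le_of_ne hA0 (Ne.symm (left_ne_zero_of_mul hAB))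
  have hBp : 0 < B := lt_of_le_of_ne hB0 (Ne.symm (right_ne_zero_of_mul hAB))
  set z := W (u.mul v) with hzdef
  have hnorm : ∀ (w : Test n) (c : ℂ) (D : ℝ), D = (sN s p w.toSchwartz).toReal → 0 < D →
      ‖c‖ = D⁻¹ → sN s p (c • w).toSchwartz ≤ 1 := by
    intro w c D hD hDp hc
    rw [Test.toSchwartz_smul, sN_smul, ← ENNReal.ofReal_toReal (sN_lt_top s p w.toSchwartz).ne,
      ← hD, ← ofReal_norm, hc, ← ENNReal.ofReal_mul (by positivity),
      inv_mul_cancel₀ hDp.ne', ENNReal.ofReal_one]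
  have hsupp : ∀ (w : Test n) (c : ℂ), tsupport (w : Rn n → ℂ) ⊆ Metric.ball 0 r →
      tsupport ((c • w : Test n) : Rn n → ℂ) ⊆ Metric.ball 0 r := by
    intro w c hw
    exact (tsupport_smul_subset_right (fun _ : Rn n ↦ c) (w : Rn n → ℂ)).trans hw
  -- Besides normalizing, the scalar on u rotates the phase, so that the value of the form becomes
  -- the positive number |z|/(AB).
  refine ⟨((starRingEnd ℂ z) / ((‖z‖ * A : ℝ) : ℂ)) • u, ((B⁻¹ : ℝ) : ℂ) • v, hsupp _ _ hu,
    hsupp _ _ hv, hnorm u _ A hA hAp ?_, hnorm v _ B hBdef hBp ?_, ‖z‖ / (A * B), ?_, ?_⟩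
  · rw [norm_div, RCLike.norm_conj, Complex.norm_real, Real.norm_of_nonneg (by positivity)]
    field_simp
  · rw [Complex.norm_real, Real.norm_of_nonneg (by positivity)]
  · rw [lt_div_iff₀ (by positivity)]
    linarith
  · rw [Test.smul_mul_smul, map_smul, smul_eq_mul, ← hzdef, mul_right_comm, div_mul_eq_mul_div,
      mul_comm ((starRingEnd ℂ) z), Complex.mul_conj, Complex.normSq_eq_norm_sq]
    have : (‖z‖ : ℂ) ≠ 0 := by exact_mod_cast hz.ne'
    have : (A : ℂ) ≠ 0 := by exact_mod_cast hAp.ne'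
    have : (B : ℂ) ≠ 0 := by exact_mod_cast hBp.ne'
    push_cast
    field_simp

/-- The gain is 2^{1/p} < √2: two almost extremal pairs living at different scales, added and
subtracted, would beat the best constant unless the infimum of the constants valid on some ball is
zero. -/
theorem exists_ball_bilinear_le (hn : 2 ≤ n) {s : ℝ} {p : ℝ≥0∞} (hp : 2 < p) (hp' : p ≠ ∞)
    (hB : Concentrates n s p) {W : Distr n} {M : ℝ}
    (hW : ∀ u v : Test n, ‖W (u.mul v)‖ ≤
      M * (sN s p u.toSchwartz).toReal * (sN s p v.toSchwartz).toReal) {δ : ℝ} (hδ : 0 < δ) :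
    ∃ r : ℝ, 0 < r ∧ ∀ u v : Test n, tsupport (u : Rn n → ℂ) ⊆ Metric.ball 0 r →
      tsupport (v : Rn n → ℂ) ⊆ Metric.ball 0 r → ‖W (u.mul v)‖ ≤
      δ * (sN s p u.toSchwartz).toReal * (sN s p v.toSchwartz).toReal := by
  have hp1 : 1 ≤ p := (one_le_two.trans hp.le)
  have hpr : 2 < p.toReal := by
    rw [← ENNReal.toReal_ofNat]
    exact (ENNReal.toReal_lt_toReal (by simp) hp').2 hp
  let P : ℝ → ℝ → Prop := fun a r ↦ ∀ u v : Test n, tsupport (u : Rn n → ℂ) ⊆ Metric.ball 0 r →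
      tsupport (v : Rn n → ℂ) ⊆ Metric.ball 0 r → ‖W (u.mul v)‖ ≤
      a * (sN s p u.toSchwartz).toReal * (sN s p v.toSchwartz).toReal
  let A : Set ℝ := {a | 0 ≤ a ∧ ∃ r : ℝ, 0 < r ∧ P a r}
  have hAup : ∀ a ∈ A, ∀ b, a ≤ b → b ∈ A := by
    rintro a ⟨ha0, r, hr, ha⟩ b hab
    refine ⟨ha0.trans hab, r, hr, fun u v hu hv ↦ (ha u v hu hv).trans ?_⟩
    gcongr
  have hAne : A.Nonempty := by
    refine ⟨|M|, abs_nonneg M, 1, one_pos, fun u v _ _ ↦ (hW u v).trans ?_⟩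
    gcongr
    exact le_abs_self M
  have hAbdd : BddBelow A := ⟨0, fun a ha ↦ ha.1⟩
  have hη0 : 0 ≤ sInf A := le_csInf hAne fun a ha ↦ ha.1
  have hgt : ∀ a, sInf A < a → a ∈ A := by
    intro a ha
    obtain ⟨b, hb, hba⟩ := exists_lt_of_csInf_lt hAne ha
    exact hAup b hb a hba.le
  suffices sInf A = 0 from (hgt δ (by rw [this]; exact hδ)).2
  by_contra hne
  have hη : 0 < sInf A := lt_of_le_of_ne hη0 (Ne.symm hne)
  set η := sInf A with hηdef
  have hk1 : (2 : ℝ) ^ (1 / p.toReal) < 2 ^ (1 / 2 : ℝ) :=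
    Real.rpow_lt_rpow_of_exponent_lt one_lt_two
      (one_div_lt_one_div_of_lt two_pos hpr)
  -- The gap between 2^{1/p} and κ absorbs the tails, the gap between κ and √2 the defect from
  -- extremality.
  obtain ⟨κ, hκ1, hκ2⟩ := exists_between hk1
  have hκ0 : 0 < κ := (by positivity : (0 : ℝ) < 2 ^ (1 / p.toReal)).trans hκ1
  have hκsq : κ ^ 2 < 2 := by
    calc κ ^ 2 < ((2 : ℝ) ^ (1 / 2 : ℝ)) ^ 2 := by gcongr
      _ = 2 := by rw [← Real.rpow_natCast, ← Real.rpow_mul (by norm_num)]; norm_num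
  -- Chosen so that (1+θ)κ² = 2(1-θ): the upper bound 2η(1+θ)κ² for the parallelogram sum then
  -- equals its strict lower bound 4η(1-θ).
  set θ := (2 - κ ^ 2) / (2 + κ ^ 2) with hθ
  have hθ0 : 0 < θ := div_pos (by linarith) (by positivity)
  have hθ1 : θ ≤ 1 := by rw [hθ, div_le_one (by positivity)]; nlinarith
  have hθκ : (1 + θ) * κ ^ 2 = 2 * (1 - θ) := by
    rw [hθ]; field_simp; ring
  obtain ⟨-, r, hr, ha⟩ := hgt (η * (1 + θ)) (by nlinarith)
  have hnb : ∀ r', 0 < r' → ¬ P (η * (1 - θ)) r' := by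
    intro r' hr' hP
    have : η ≤ η * (1 - θ) := csInf_le hAbdd ⟨by nlinarith, r', hr', hP⟩
    nlinarith
  obtain ⟨u₁, v₁, hu₁, hv₁, hNu₁, hNv₁, a₁, ha₁, hWa₁⟩ :=
    exists_normalized (by nlinarith) hW (hnb r hr)
  set τ := (κ - 2 ^ (1 / p.toReal)) / 2 with hτdef
  have hτ : 0 < τ := by rw [hτdef]; linarith
  have hτκ : (2 : ℝ≥0∞) ^ (1 / p.toReal) + 2 * ENNReal.ofReal τ = ENNReal.ofReal κ := by
    have e1 : (2 : ℝ≥0∞) ^ (1 / p.toReal) = ENNReal.ofReal (2 ^ (1 / p.toReal)) := by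
      rw [← ENNReal.ofReal_rpow_of_pos two_pos]; simp
    have e2 : (2 : ℝ≥0∞) = ENNReal.ofReal 2 := by simp
    rw [e1, e2, ← ENNReal.ofReal_mul two_pos.le, ← ENNReal.ofReal_add (by positivity)
      (by positivity)]
    congr 1
    rw [hτdef]; ring
  obtain ⟨ru, hru, hu⟩ := hB.exists_sN_add_le hn hp1 hp' u₁ hNu₁ hτ
  obtain ⟨rv, hrv, hv⟩ := hB.exists_sN_add_le hn hp1 hp' v₁ hNv₁ hτ
  rw [hτκ] at hu hv
  -- The second pair is taken at a scale that depends on the first pair through `ru` and `rv`.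
  have hr2 : 0 < min r (min ru rv) := by positivity
  obtain ⟨u₂, v₂, hu₂, hv₂, hNu₂, hNv₂, a₂, ha₂, hWa₂⟩ :=
    exists_normalized (by nlinarith) hW (hnb _ hr2)
  have hrr : Metric.ball (0 : Rn n) (min r (min ru rv)) ⊆ Metric.ball 0 r :=
    Metric.ball_subset_ball (min_le_left _ _)
  obtain ⟨hup, hum⟩ := hu u₂ (hu₂.trans (Metric.ball_subset_ball
    ((min_le_right _ _).trans (min_le_left _ _)))) hNu₂
  obtain ⟨hvp, hvm⟩ := hv v₂ (hv₂.trans (Metric.ball_subset_ball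
    ((min_le_right _ _).trans (min_le_right _ _)))) hNv₂
  have hadd : ∀ w₁ w₂ : Test n, tsupport (w₁ : Rn n → ℂ) ⊆ Metric.ball 0 r →
      tsupport (w₂ : Rn n → ℂ) ⊆ Metric.ball 0 r →
      tsupport ((w₁ + w₂ : Test n) : Rn n → ℂ) ⊆ Metric.ball 0 r := fun w₁ w₂ h₁ h₂ ↦
    (tsupport_add (w₁ : Rn n → ℂ) (w₂ : Rn n → ℂ)).trans (Set.union_subset h₁ h₂)
  have hneg : ∀ w : Test n, tsupport (w : Rn n → ℂ) ⊆ Metric.ball 0 r →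
      tsupport ((-w : Test n) : Rn n → ℂ) ⊆ Metric.ball 0 r := fun w h ↦
    (tsupport_neg (w : Rn n → ℂ)).subset.trans h
  have hmain : ∀ w z : Test n, tsupport (w : Rn n → ℂ) ⊆ Metric.ball 0 r →
      tsupport (z : Rn n → ℂ) ⊆ Metric.ball 0 r →
      sN s p w.toSchwartz ≤ ENNReal.ofReal κ → sN s p z.toSchwartz ≤ ENNReal.ofReal κ →
      ‖W (w.mul z)‖ ≤ η * (1 + θ) * κ * κ := by
    intro w z hw hz hNw hNz
    refine (ha w z hw hz).trans ?_
    gcongr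
    · exact ENNReal.toReal_le_of_le_ofReal hκ0.le hNw
    · exact ENNReal.toReal_le_of_le_ofReal hκ0.le hNz
  have h1 := hmain _ _ (hadd _ _ hu₁ (hu₂.trans hrr)) (hadd _ _ hv₁ (hv₂.trans hrr)) hup hvp
  have h2 := hmain _ _ (hadd _ _ hu₁ (hneg _ (hu₂.trans hrr)))
    (hadd _ _ hv₁ (hneg _ (hv₂.trans hrr))) hum hvm
  have h3 := norm_add_le (W ((u₁ + u₂).mul (v₁ + v₂))) (W ((u₁ + -u₂).mul (v₁ + -v₂)))
  rw [parallelogram_apply, hWa₁, hWa₂, ← Complex.ofReal_add, norm_mul, Complex.norm_real] at h3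
  have h4 : a₁ + a₂ ≤ ‖a₁ + a₂‖ := le_abs_self _
  have h5 : ‖(2 : ℂ)‖ = 2 := by simp
  rw [h5] at h3
  have h6 : η * (1 + θ) * κ * κ = 2 * (η * (1 - θ)) := by
    linear_combination η * hθκ
  linarith

/-! ### Localization of the multiplier -/

/-- Multiplication by cutoffs at scale `ρ` is bounded on `W^{s,p}`, uniformly in `ρ`. -/
def UniformCutoffs (n : ℕ) (s : ℝ) (p : ℝ≥0∞) : Prop :=
  ∃ C : ℝ≥0∞, C < ∞ ∧ ∀ ρ : ℝ, 0 < ρ → ∃ χ : Test n, (∀ x ∈ Metric.ball (0 : Rn n) ρ, χ x = 1) ∧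
    tsupport (χ : Rn n → ℂ) ⊆ Metric.ball 0 (3 * ρ) ∧
    ∀ u : 𝓢(Rn n, ℂ), sN s p (χ.mulCLM u).toSchwartz ≤ C * sN s p u

/-- The extension is χ²W rather than χW: its form at (u, v) is W(χu·χv), and χu and χv are both test
functions supported in the small ball, although v is only Schwartz. -/
theorem tendsto_normXOn (hn : 2 ≤ n) {ε : ℝ} (hA : UniformCutoffs n (expS n ε) (expP n))
    (hB : Concentrates n (expS n ε) (expP n)) {W : Distr n} (hW : MemX ε W) :
    Filter.Tendsto (fun α : ℝ ↦ normXOn ε (Metric.ball (0 : Rn n) α) W) (𝓝[>] 0) (𝓝 0) := by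
  have hconj := holderConjugate_exp hn
  obtain ⟨C, hC, hA⟩ := hA
  obtain ⟨M, hM, hbound⟩ := hW.exists_bound hn
  have hp2 : 2 < expP n := by
    have h : (2 : ℝ) ≤ n := by exact_mod_cast hn
    rw [expP, ← ENNReal.ofReal_ofNat, ENNReal.ofReal_lt_ofReal_iff_of_nonneg (by norm_num),
      lt_div_iff₀ (by linarith)]
    linarith
  have hbound' : ∀ u v : Test n, ‖W (u.mul v)‖ ≤ M.toReal *
      (sN (expS n ε) (expP n) u.toSchwartz).toReal *
      (sN (expS n ε) (expP n) v.toSchwartz).toReal := by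
    intro u v
    rw [← toReal_enorm, ← ENNReal.toReal_mul, ← ENNReal.toReal_mul]
    exact ENNReal.toReal_mono (ENNReal.mul_ne_top (ENNReal.mul_ne_top hM.ne
      (sN_lt_top _ _ _).ne) (sN_lt_top _ _ _).ne) (hbound u v.toSchwartz)
  rw [ENNReal.tendsto_nhds_zero]
  intro η hη
  have hD : C * C + 1 ≠ ∞ := by simp [ENNReal.mul_eq_top, hC.ne]
  -- The minimum with 1 keeps the norm of χ²W finite when η is infinite, as membership in X
  -- requires.
  obtain ⟨δ, hδ0, hδ, hδη⟩ := ENNReal.lt_iff_exists_real_btwn.1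
    (ENNReal.div_pos (ne_of_gt (lt_min hη one_pos)) hD)
  have hδpos : 0 < δ := ENNReal.ofReal_pos.1 hδ
  have hle : ENNReal.ofReal δ * (C * C) ≤ min η 1 := by
    calc ENNReal.ofReal δ * (C * C) ≤ (min η 1 / (C * C + 1)) * (C * C + 1) := by
          gcongr
          exact le_self_add
      _ ≤ min η 1 := ENNReal.mul_le_of_le_div le_rfl
  obtain ⟨r, hr, hsmall⟩ := exists_ball_bilinear_le hn hp2 expP_ne_top hB hbound' hδpos
  filter_upwards [Ioo_mem_nhdsGT (show 0 < r / 3 by positivity)] with α hα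
  obtain ⟨χ, hχ1, hχs, hχ⟩ := hA α hα.1
  have hsub : Metric.ball (0 : Rn n) (3 * α) ⊆ Metric.ball 0 r :=
    Metric.ball_subset_ball (by linarith [hα.2])
  have hnorm : normX ε (W.cutoff (χ.mul χ)) ≤ min η 1 := by
    refine normX_cutoff_le hn hW _ fun u v ↦ ?_
    have e : ((χ.mul χ).mul u).mulCLM v = (χ.mul u).mul (χ.mulCLM v) := by
      ext x
      change χ x * χ x * u x * v x = χ x * u x * (χ x * v x)
      ring
    have hs : ∀ w : 𝓢(Rn n, ℂ), tsupport (χ.mulCLM w : Rn n → ℂ) ⊆ Metric.ball 0 r := fun w ↦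
      (tsupport_mul_subset_left (f := (χ : Rn n → ℂ)) (g := w)).trans (hχs.trans hsub)
    have h1 := hsmall (χ.mul u) (χ.mulCLM v) (hs _) (hs _)
    rw [e]
    have h2 : ‖W ((χ.mul u).mul (χ.mulCLM v))‖ₑ ≤ ENNReal.ofReal δ *
        sN (expS n ε) (expP n) (χ.mul u).toSchwartz *
        sN (expS n ε) (expP n) (χ.mulCLM v).toSchwartz := by
      rw [← ENNReal.toReal_le_toReal enorm_ne_top (ENNReal.mul_ne_top (ENNReal.mul_ne_top
        ENNReal.ofReal_ne_top (sN_lt_top _ _ _).ne) (sN_lt_top _ _ _).ne), toReal_enorm,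
        ENNReal.toReal_mul, ENNReal.toReal_mul, ENNReal.toReal_ofReal hδpos.le]
      exact h1
    calc _ ≤ ENNReal.ofReal δ * (C * sN (expS n ε) (expP n) u.toSchwartz) *
          (C * sN (expS n ε) (expP n) v) := by
          refine h2.trans ?_
          gcongr
          · exact hχ u.toSchwartz
          · exact hχ v
      _ = ENNReal.ofReal δ * (C * C) * sN (expS n ε) (expP n) u.toSchwartz *
          sN (expS n ε) (expP n) v := by ring
      _ ≤ _ := by gcongr
  refine iInf_le_of_le (W.cutoff (χ.mul χ)) (iInf_le_of_le (hW.cutoff _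
    (hnorm.trans_lt ((min_le_right _ _).trans_lt ENNReal.one_lt_top)))
    (iInf_le_of_le ?_ (hnorm.trans (min_le_left _ _))))
  intro φ hφ
  rw [Distr.cutoff_apply]
  congr 1
  ext x
  change χ x * χ x * φ x = φ x
  by_cases hx : x ∈ tsupport (φ : Rn n → ℂ)
  · rw [hχ1 x (hφ hx), one_mul, one_mul]
  · rw [image_eq_zero_of_notMem_tsupport hx, mul_zero]

/-! ### Cutoffs, modulations and the case of negative s -/

/-- A smooth bump function, equal to `1` on the unit ball and supported in the ball of
radius `2`. -/
def bump (n : ℕ) : ContDiffBump (0 : Rn n) := ⟨1, 2, one_pos, one_lt_two⟩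

/-- The rescaled bump function, equal to `1` on the ball of radius `ρ`. -/
def cutoffAt (n : ℕ) {ρ : ℝ} (hρ : 0 < ρ) : Test n where
  toFun x := ((bump n (ρ⁻¹ • x) : ℝ) : ℂ)
  contDiff' := Complex.ofRealCLM.contDiff.comp
    ((bump n).contDiff.comp (contDiff_const_smul ρ⁻¹))
  hasCompactSupport' := by
    have h1 : HasCompactSupport fun x : Rn n ↦ bump n (ρ⁻¹ • x) :=
      (bump n).hasCompactSupport.comp_smul (inv_ne_zero hρ.ne')
    exact h1.comp_left (g := Complex.ofReal) rfl
  tsupport_subset' := Set.subset_univ _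

theorem cutoffAt_apply {ρ : ℝ} (hρ : 0 < ρ) (x : Rn n) :
    cutoffAt n hρ x = ((bump n (ρ⁻¹ • x) : ℝ) : ℂ) := rfl

theorem cutoffAt_eq_one {ρ : ℝ} (hρ : 0 < ρ) {x : Rn n} (hx : ‖x‖ ≤ ρ) : cutoffAt n hρ x = 1 := by
  rw [cutoffAt_apply, (bump n).one_of_mem_closedBall, Complex.ofReal_one]
  change ρ⁻¹ • x ∈ Metric.closedBall 0 1
  rw [mem_closedBall_zero_iff, norm_smul, norm_inv, Real.norm_of_nonneg hρ.le]
  rwa [inv_mul_le_iff₀ hρ, mul_one]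

theorem cutoffAt_eq_zero {ρ : ℝ} (hρ : 0 < ρ) {x : Rn n} (hx : 2 * ρ ≤ ‖x‖) :
    cutoffAt n hρ x = 0 := by
  rw [cutoffAt_apply, (bump n).zero_of_le_dist, Complex.ofReal_zero]
  change 2 ≤ dist (ρ⁻¹ • x) 0
  rw [dist_zero_right, norm_smul, norm_inv, Real.norm_of_nonneg hρ.le]
  rwa [← div_eq_inv_mul, le_div_iff₀ hρ]

theorem norm_cutoffAt_le {ρ : ℝ} (hρ : 0 < ρ) (x : Rn n) : ‖cutoffAt n hρ x‖ ≤ 1 := by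
  rw [cutoffAt_apply, Complex.norm_real, Real.norm_of_nonneg (bump n).nonneg]
  exact (bump n).le_one

theorem tsupport_cutoffAt {ρ : ℝ} (hρ : 0 < ρ) :
    tsupport (cutoffAt n hρ : Rn n → ℂ) ⊆ Metric.ball 0 (3 * ρ) := by
  refine (closure_minimal (t := Metric.closedBall 0 (2 * ρ)) (fun x hx ↦ ?_)
    Metric.isClosed_closedBall).trans (Metric.closedBall_subset_ball (by linarith))
  rw [mem_closedBall_zero_iff]
  by_contra h
  exact hx (cutoffAt_eq_zero hρ (not_le.1 h).le)

/-- The modulation `e^{2πi k·x} u(x)` of a test function. -/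
def Test.modulate (u : Test n) (k : Rn n) : Test n where
  toFun x := Complex.exp ((2 * Real.pi * inner ℝ k x : ℝ) * Complex.I) * u x
  contDiff' := by
    refine ContDiff.mul (Complex.contDiff_exp.comp (ContDiff.mul
      (Complex.ofRealCLM.contDiff.comp ?_) contDiff_const)) u.contDiff
    exact contDiff_const.mul (contDiff_const.inner ℝ contDiff_id)
  hasCompactSupport' := u.hasCompactSupport.mul_left
  tsupport_subset' := Set.subset_univ _

theorem Test.modulate_apply (u : Test n) (k x : Rn n) :
    u.modulate k x = Complex.exp ((2 * Real.pi * inner ℝ k x : ℝ) * Complex.I) * u x := rfl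

theorem fourier_modulate (u : Test n) (k ξ : Rn n) :
    𝓕 (u.modulate k).toSchwartz ξ = 𝓕 u.toSchwartz (ξ - k) := by
  rw [SchwartzMap.fourier_coe, SchwartzMap.fourier_coe, Real.fourier_eq', Real.fourier_eq']
  refine integral_congr_ae (Filter.Eventually.of_forall fun x ↦ ?_)
  simp only [Test.toSchwartz_apply, Test.modulate_apply, smul_eq_mul, ← mul_assoc,
    ← Complex.exp_add]
  congr 2
  rw [inner_sub_right, real_inner_comm x k]
  push_cast
  ring

theorem fourier_japS (s : ℝ) (u : 𝓢(Rn n, ℂ)) (ξ : Rn n) :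
    𝓕 (japS n s u) ξ = japSymbol n s ξ * 𝓕 u ξ := by
  rw [japS, SchwartzMap.fourierMultiplierCLM_apply, FourierTransform.fourier_fourierInv_eq,
    SchwartzMap.smulLeftCLM_apply_apply (japSymbol_hasTemperateGrowth n s), smul_eq_mul]

theorem japS_apply (s : ℝ) (u : 𝓢(Rn n, ℂ)) (x : Rn n) :
    japS n s u x = ∫ ξ, Complex.exp ((2 * Real.pi * inner ℝ ξ x : ℝ) * Complex.I) *
      (japSymbol n s ξ * 𝓕 u ξ) := by
  conv_lhs => rw [← FourierTransform.fourierInv_fourier_eq (F := 𝓢(Rn n, ℂ)) (japS n s u)]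
  rw [SchwartzMap.fourierInv_coe, Real.fourierInv_eq']
  simp only [fourier_japS, smul_eq_mul]

theorem norm_japSymbol (s : ℝ) (ξ : Rn n) :
    ‖japSymbol n s ξ‖ = (1 + ‖(2 * Real.pi) • ξ‖ ^ 2) ^ (s / 2) := by
  rw [japSymbol, Complex.norm_real, Real.norm_of_nonneg (by positivity)]

theorem norm_japSymbol_le_one {s : ℝ} (hs : s ≤ 0) (ξ : Rn n) : ‖japSymbol n s ξ‖ ≤ 1 := by
  rw [norm_japSymbol]
  refine Real.rpow_le_one_of_one_le_of_nonpos ?_ (by linarith)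
  have : 0 ≤ ‖(2 * Real.pi) • ξ‖ ^ 2 := by positivity
  linarith

theorem continuous_japSymbol (s : ℝ) : Continuous (japSymbol n s) :=
  (japSymbol_hasTemperateGrowth n s).1.continuous

theorem tendsto_japSymbol {s : ℝ} (hs : s < 0) {e : Rn n} (he : e ≠ 0) (ξ : Rn n) :
    Filter.Tendsto (fun N : ℕ ↦ ‖japSymbol n s (ξ + (N : ℝ) • e)‖) Filter.atTop (𝓝 0) := by
  simp only [norm_japSymbol]
  have h1 : Filter.Tendsto (fun x : ℝ ↦ x ^ (s / 2)) Filter.atTop (𝓝 0) := by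
    have := tendsto_rpow_neg_atTop (y := -(s / 2)) (by linarith)
    simpa using this
  refine h1.comp (Filter.tendsto_atTop_add_const_left _ _ ?_)
  refine (Filter.tendsto_pow_atTop two_ne_zero).comp ?_
  have h2 : Filter.Tendsto (fun N : ℕ ↦ (2 * Real.pi) * ((N : ℝ) * ‖e‖ - ‖ξ‖)) Filter.atTop
      Filter.atTop := by
    refine Filter.Tendsto.const_mul_atTop (by positivity) ?_
    refine Filter.tendsto_atTop_add_const_right _ _ ?_
    exact tendsto_natCast_atTop_atTop.atTop_mul_const (norm_pos_iff.2 he)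
  refine Filter.tendsto_atTop_mono (fun N ↦ ?_) h2
  rw [norm_smul, Real.norm_of_nonneg (by positivity)]
  gcongr
  have := norm_sub_norm_le ((N : ℝ) • e) (-ξ)
  rw [norm_smul, norm_neg, sub_neg_eq_add, add_comm ((N : ℝ) • e), Real.norm_natCast] at this
  exact this

/-- Modulation moves the frequencies to where a symbol of negative order is small. The sup norm
tends to zero by dominated convergence, the L² norm stays bounded by Plancherel, and p > 2 lets one
interpolate. -/
theorem tendsto_sN_modulate {s : ℝ} (hs : s < 0) {p : ℝ≥0∞} (hp : 2 < p) (hp' : p ≠ ∞)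
    (u : Test n) {e : Rn n} (he : e ≠ 0) :
    Filter.Tendsto (fun N : ℕ ↦ sN s p (u.modulate ((N : ℝ) • e)).toSchwartz)
      Filter.atTop (𝓝 0) := by
  have hpr : 2 < p.toReal := by
    rw [← ENNReal.toReal_ofNat]
    exact (ENNReal.toReal_lt_toReal (by simp) hp').2 hp
  have hp0 : p ≠ 0 := (zero_lt_two.trans hp).ne'
  set F := 𝓕 u.toSchwartz with hF
  let S : ℕ → ℝ := fun N ↦ ∫ ξ, ‖japSymbol n s (ξ + (N : ℝ) • e)‖ * ‖F ξ‖
  have hS : Filter.Tendsto S Filter.atTop (𝓝 0) := by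
    have := tendsto_integral_of_dominated_convergence (μ := (volume : Measure (Rn n)))
      (F := fun (N : ℕ) ξ ↦ ‖japSymbol n s (ξ + (N : ℝ) • e)‖ * ‖F ξ‖) (f := fun _ ↦ 0)
      (fun ξ ↦ ‖F ξ‖) ?_ F.integrable.norm ?_ ?_
    · simpa using this
    · intro N
      have h1 : Continuous fun ξ : Rn n ↦ ‖japSymbol n s (ξ + (N : ℝ) • e)‖ * ‖F ξ‖ :=
        ((continuous_japSymbol s).comp (continuous_id.add continuous_const)).norm.mul
          F.continuous.norm
      exact h1.aestronglyMeasurable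
    · intro N
      refine Filter.Eventually.of_forall fun ξ ↦ ?_
      rw [Real.norm_of_nonneg (by positivity)]
      exact mul_le_of_le_one_left (norm_nonneg _) (norm_japSymbol_le_one hs.le _)
    · refine Filter.Eventually.of_forall fun ξ ↦ ?_
      simpa using (tendsto_japSymbol hs he ξ).mul_const ‖F ξ‖
  let B : ℝ≥0∞ := ENNReal.ofReal (∫ ξ, ‖F ξ‖ ^ 2)
  have hsup : ∀ (N : ℕ) (x : Rn n),
      ‖japS n s (u.modulate ((N : ℝ) • e)).toSchwartz x‖ ≤ S N := by
    intro N x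
    rw [japS_apply]
    refine (norm_integral_le_integral_norm _).trans_eq ?_
    simp only [norm_mul, Complex.norm_exp_ofReal_mul_I, one_mul, fourier_modulate]
    rw [← integral_add_right_eq_self _ ((N : ℝ) • e)]
    simp only [add_sub_cancel_right]
    rfl
  have hL2 : ∀ N : ℕ, ∫⁻ x, ‖japS n s (u.modulate ((N : ℝ) • e)).toSchwartz x‖ₑ ^ (2 : ℝ) ≤ B := by
    intro N
    set g := japS n s (u.modulate ((N : ℝ) • e)).toSchwartz with hg
    have h1 : ∫⁻ x, ‖g x‖ₑ ^ (2 : ℝ) = ENNReal.ofReal (∫ x, ‖g x‖ ^ 2) := by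
      rw [ofReal_integral_eq_lintegral_ofReal
        (by simpa using (g.memLp 2 volume).integrable_norm_pow two_ne_zero)
        (Filter.Eventually.of_forall fun x ↦ by positivity)]
      refine lintegral_congr fun x ↦ ?_
      rw [← ofReal_norm, ENNReal.ofReal_rpow_of_nonneg (norm_nonneg _) two_pos.le]
      norm_num
    rw [h1, ← SchwartzMap.integral_norm_sq_fourier]
    refine ENNReal.ofReal_le_ofReal ?_
    rw [← integral_sub_right_eq_self (fun ξ ↦ ‖F ξ‖ ^ 2) ((N : ℝ) • e)]
    have hi : Integrable (fun ξ ↦ ‖F ξ‖ ^ 2) volume := by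
      simpa using (F.memLp 2 volume).integrable_norm_pow two_ne_zero
    refine integral_mono_of_nonneg (Filter.Eventually.of_forall fun x ↦ by positivity)
      (hi.comp_sub_right _) (Filter.Eventually.of_forall fun ξ ↦ ?_)
    simp only [hg, fourier_japS, fourier_modulate, norm_mul]
    gcongr
    exact mul_le_of_le_one_left (norm_nonneg _) (norm_japSymbol_le_one hs.le _)
  have hle : ∀ N : ℕ, sN s p (u.modulate ((N : ℝ) • e)).toSchwartz ≤
      (ENNReal.ofReal (S N) ^ (p.toReal - 2) * B) ^ (1 / p.toReal) := by
    intro N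
    rw [sN, eLpNorm_eq_lintegral_rpow_enorm_toReal hp0 hp']
    refine ENNReal.rpow_le_rpow ?_ (by positivity)
    calc _ ≤ ∫⁻ x, ENNReal.ofReal (S N) ^ (p.toReal - 2) *
          ‖japS n s (u.modulate ((N : ℝ) • e)).toSchwartz x‖ₑ ^ (2 : ℝ) := by
          refine lintegral_mono fun x ↦ ?_
          have : p.toReal = (p.toReal - 2) + 2 := by ring
          conv_lhs => rw [this]
          rw [ENNReal.rpow_add_of_nonneg _ _ (by linarith) two_pos.le]
          gcongr
          rw [← ofReal_norm]
          exact ENNReal.ofReal_le_ofReal (hsup N x)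
      _ ≤ _ := by
          rw [lintegral_const_mul' _ _ (ENNReal.rpow_ne_top_of_nonneg (by linarith)
            ENNReal.ofReal_ne_top)]
          gcongr
          exact hL2 N
  refine tendsto_of_tendsto_of_tendsto_of_le_of_le tendsto_const_nhds ?_ (fun _ ↦ zero_le) hle
  have h1 : Filter.Tendsto (fun N ↦ ENNReal.ofReal (S N) ^ (p.toReal - 2)) Filter.atTop (𝓝 0) := by
    have := (ENNReal.continuous_rpow_const (y := p.toReal - 2)).tendsto 0
    rw [ENNReal.zero_rpow_of_pos (by linarith)] at this
    refine this.comp ?_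
    simpa using ENNReal.tendsto_ofReal hS
  have h2 := ENNReal.Tendsto.mul_const (b := B) h1 (Or.inr ENNReal.ofReal_ne_top)
  rw [zero_mul] at h2
  have h3 := (ENNReal.continuous_rpow_const (y := 1 / p.toReal)).tendsto 0
  rw [ENNReal.zero_rpow_of_pos (by positivity)] at h3
  exact h3.comp h2

/-- A multiplier that gains derivatives vanishes. -/
theorem eq_zero_of_neg (hn : 2 ≤ n) {s : ℝ} (hs : s < 0) {p : ℝ≥0∞} (hp : 2 < p) (hp' : p ≠ ∞)
    {W : Distr n} {M : ℝ≥0∞} (hM : M < ∞) (hW : ∀ (u : Test n) (v : 𝓢(Rn n, ℂ)),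
      ‖W (u.mulCLM v)‖ₑ ≤ M * sN s p u.toSchwartz * sN s p v) : W = 0 := by
  ext φ
  obtain ⟨R, hR⟩ := φ.hasCompactSupport.isCompact.isBounded.exists_norm_le
  have hR1 : 0 < |R| + 1 := by positivity
  let e : Rn n := EuclideanSpace.single ⟨0, by omega⟩ 1
  have he : e ≠ 0 := by simp [e]
  let u : ℕ → Test n := fun N ↦ φ.modulate ((N : ℝ) • e)
  -- The opposite modulation keeps the product equal to φ for every N, the cutoff being 1 on the
  -- support of φ.
  let v : ℕ → Test n := fun N ↦ (cutoffAt n hR1).modulate ((N : ℝ) • -e)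
  have huv : ∀ N, (u N).mulCLM (v N).toSchwartz = φ := by
    intro N
    ext x
    rw [Test.mulCLM_apply, Test.toSchwartz_apply]
    simp only [u, v, Test.modulate_apply]
    by_cases hx : x ∈ tsupport (φ : Rn n → ℂ)
    · rw [cutoffAt_eq_one hR1 ((hR x hx).trans ((le_abs_self R).trans (by linarith))), mul_one,
        mul_right_comm, ← Complex.exp_add]
      simp
    · rw [image_eq_zero_of_notMem_tsupport hx]
      simp
  have h1 := tendsto_sN_modulate hs hp hp' φ he
  have h2 := tendsto_sN_modulate hs hp hp' (cutoffAt n hR1) (neg_ne_zero.2 he)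
  have h3 := ENNReal.Tendsto.mul (ENNReal.Tendsto.const_mul (a := M) h1 (Or.inr hM.ne))
    (Or.inr (by simp)) h2 (Or.inr (by simp))
  rw [mul_zero] at h3
  have h4 : ‖W φ‖ₑ ≤ 0 := ge_of_tendsto' h3 fun N ↦ by
    have := hW (u N) (v N).toSchwartz
    rwa [huv] at this
  simpa using h4

/-! ### Heat kernel representation of J^s and pointwise kernel bounds -/

theorem integrableOn_rpow_mul_exp_neg_mul {b r : ℝ} (hb : 0 < b) (hr : 0 < r) :
    IntegrableOn (fun t : ℝ ↦ t ^ (b - 1) * Real.exp (-(r * t))) (Set.Ioi 0) := by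
  have := integrableOn_rpow_mul_exp_neg_mul_rpow (p := 1) (s := b - 1) (by linarith) one_pos hr
  simpa using this

/-- The substitution t ↦ 1/t reduces the time integrals of the heat kernel to Gamma integrals. -/
theorem rpow_inv_subst {b r t : ℝ} (ht : 0 < t) :
    (|(-1 : ℝ)| * t ^ ((-1 : ℝ) - 1)) • ((t ^ (-1 : ℝ)) ^ (b - 1) *
      Real.exp (-(r * t ^ (-1 : ℝ)))) = t ^ (-b - 1) * Real.exp (-(r / t)) := by
  rw [abs_neg, abs_one, one_mul, smul_eq_mul, ← mul_assoc, ← Real.rpow_mul ht.le,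
    ← Real.rpow_add ht, Real.rpow_neg_one, div_eq_mul_inv]
  congr 2
  ring

theorem integrableOn_rpow_mul_exp_neg_div {b r : ℝ} (hb : 0 < b) (hr : 0 < r) :
    IntegrableOn (fun t : ℝ ↦ t ^ (-b - 1) * Real.exp (-(r / t))) (Set.Ioi 0) := by
  refine IntegrableOn.congr_fun ((integrableOn_Ioi_comp_rpow_iff
    (fun t : ℝ ↦ t ^ (b - 1) * Real.exp (-(r * t))) (p := -1) (by norm_num)).2
    (integrableOn_rpow_mul_exp_neg_mul hb hr)) (fun t ht ↦ rpow_inv_subst ht) measurableSet_Ioi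

theorem integral_rpow_mul_exp_neg_div {b r : ℝ} (hb : 0 < b) (hr : 0 < r) :
    ∫ t in Set.Ioi (0 : ℝ), t ^ (-b - 1) * Real.exp (-(r / t)) = (1 / r) ^ b * Real.Gamma b := by
  rw [← Real.integral_rpow_mul_exp_neg_mul_Ioi hb hr, ← integral_comp_rpow_Ioi
    (fun t : ℝ ↦ t ^ (b - 1) * Real.exp (-(r * t))) (p := -1) (by norm_num)]
  exact setIntegral_congr_fun measurableSet_Ioi fun t ht ↦ (rpow_inv_subst ht).symm

/-- The heat kernel. -/
def heatKernel (n : ℕ) (t : ℝ) (z : Rn n) : ℝ :=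
  (4 * Real.pi * t) ^ (-(n : ℝ) / 2) * Real.exp (-(‖z‖ ^ 2 / 4 / t))

theorem heatKernel_nonneg {t : ℝ} (ht : 0 < t) (z : Rn n) : 0 ≤ heatKernel n t z := by
  unfold heatKernel
  positivity

theorem measurable_heatKernel (n : ℕ) :
    Measurable fun q : ℝ × Rn n ↦ heatKernel n q.1 q.2 := by
  unfold heatKernel
  fun_prop

/-- The Riesz kernel `|z|^{a-n}` as an extended nonnegative real number. -/
def pw {n : ℕ} (a : ℝ) (z : Rn n) : ℝ≥0∞ := ENNReal.ofReal (‖z‖ ^ a)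

theorem measurable_pw (a : ℝ) : Measurable (pw a : Rn n → ℝ≥0∞) := by
  unfold pw
  fun_prop

/-- Negative a is allowed: for z ≠ 0 the Gaussian removes the singularity at t = 0, and a < n gives
convergence at infinity. The exponent is needed both for a = s and for a = -s. -/
theorem exists_lintegral_heatKernel_le {a : ℝ} (ha : a < n) :
    ∃ C : ℝ≥0∞, C < ∞ ∧ ∀ z : Rn n, z ≠ 0 →
      ∫⁻ t in Set.Ioi (0 : ℝ), ENNReal.ofReal (t ^ (a / 2 - 1) * heatKernel n t z) ≤
        C * pw (a - n) z := by
  set b := ((n : ℝ) - a) / 2 with hb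
  have hb0 : 0 < b := by rw [hb]; linarith
  refine ⟨ENNReal.ofReal ((4 * Real.pi) ^ (-(n : ℝ) / 2) * ((4 : ℝ) ^ b * Real.Gamma b)),
    ENNReal.ofReal_lt_top, fun z hz ↦ ?_⟩
  have hz0 : 0 < ‖z‖ := norm_pos_iff.2 hz
  have hr : 0 < ‖z‖ ^ 2 / 4 := by positivity
  have hG : 0 < Real.Gamma b := Real.Gamma_pos_of_pos hb0
  have h1 : ∀ t ∈ Set.Ioi (0 : ℝ), ENNReal.ofReal (t ^ (a / 2 - 1) * heatKernel n t z) =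
      ENNReal.ofReal ((4 * Real.pi) ^ (-(n : ℝ) / 2) *
        (t ^ (-b - 1) * Real.exp (-(‖z‖ ^ 2 / 4 / t)))) := by
    intro t ht
    have ht : 0 < t := ht
    rw [heatKernel, Real.mul_rpow (by positivity) ht.le]
    have : t ^ (-b - 1) = t ^ (a / 2 - 1) * t ^ (-(n : ℝ) / 2) := by
      rw [← Real.rpow_add ht]
      congr 1
      rw [hb]
      ring
    rw [this]
    congr 1
    ring
  rw [setLIntegral_congr_fun measurableSet_Ioi h1, ← ofReal_integral_eq_lintegral_ofReal
    ((integrableOn_rpow_mul_exp_neg_div hb0 hr).const_mul _), integral_const_mul,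
    integral_rpow_mul_exp_neg_div hb0 hr, pw, ← ENNReal.ofReal_mul (by positivity)]
  · refine ENNReal.ofReal_le_ofReal (le_of_eq ?_)
    have : (1 / (‖z‖ ^ 2 / 4)) ^ b = 4 ^ b * ‖z‖ ^ (a - n) := by
      rw [one_div_div, Real.div_rpow (by norm_num) (by positivity), ← Real.rpow_natCast,
        ← Real.rpow_mul hz0.le, div_eq_mul_inv, ← Real.rpow_neg hz0.le]
      congr 2
      rw [hb]
      push_cast
      ring
    rw [this]
    ring
  · filter_upwards [ae_restrict_mem measurableSet_Ioi] with t ht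
    have ht : 0 < t := ht
    positivity

theorem exists_lintegral_heat_le (hn : 2 ≤ n) {a : ℝ} (ha : a < n) :
    ∃ C : ℝ≥0∞, C < ∞ ∧ ∀ (x : Rn n) (q : Rn n → ℂ), AEMeasurable q volume →
      ∫⁻ t in Set.Ioi (0 : ℝ), ‖((t ^ (a / 2 - 1) * Real.exp (-t) : ℝ) : ℂ) *
        ∫ y, (heatKernel n t (x - y) : ℂ) * q y‖ₑ ≤
        C * ∫⁻ y, pw (a - n) (x - y) * ‖q y‖ₑ := by
  obtain ⟨C, hC, h⟩ := exists_lintegral_heatKernel_le ha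
  refine ⟨C, hC, fun x q hq ↦ ?_⟩
  have : Nonempty (Fin n) := ⟨⟨0, by omega⟩⟩
  calc _ ≤ ∫⁻ t in Set.Ioi (0 : ℝ), ∫⁻ y,
        ENNReal.ofReal (t ^ (a / 2 - 1) * heatKernel n t (x - y)) * ‖q y‖ₑ := by
        refine setLIntegral_mono' measurableSet_Ioi fun t ht ↦ ?_
        have ht : 0 < t := ht
        rw [enorm_mul]
        have h1 : ‖((t ^ (a / 2 - 1) * Real.exp (-t) : ℝ) : ℂ)‖ₑ ≤
            ENNReal.ofReal (t ^ (a / 2 - 1)) := by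
          rw [← ofReal_norm, Complex.norm_real, Real.norm_of_nonneg (by positivity)]
          refine ENNReal.ofReal_le_ofReal (mul_le_of_le_one_right (by positivity) ?_)
          exact Real.exp_le_one_iff.2 (by linarith)
        refine (mul_le_mul' h1 (enorm_integral_le_lintegral_enorm _)).trans_eq ?_
        rw [← lintegral_const_mul' _ _ ENNReal.ofReal_ne_top]
        refine lintegral_congr fun y ↦ ?_
        rw [enorm_mul, ← mul_assoc, ← ofReal_norm (heatKernel n t (x - y) : ℂ),
          Complex.norm_real, Real.norm_of_nonneg (heatKernel_nonneg ht _),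
          ENNReal.ofReal_mul (by positivity)]
    _ = ∫⁻ y, (∫⁻ t in Set.Ioi (0 : ℝ),
        ENNReal.ofReal (t ^ (a / 2 - 1) * heatKernel n t (x - y))) * ‖q y‖ₑ := by
        rw [lintegral_lintegral_swap]
        · refine lintegral_congr fun y ↦ ?_
          rw [lintegral_mul_const' _ _ enorm_ne_top]
        · have h2 : Measurable fun w : ℝ × Rn n ↦ heatKernel n w.1 (x - w.2) :=
            (measurable_heatKernel n).comp
              (measurable_fst.prodMk (measurable_const.sub measurable_snd))
          have h3 : Measurable fun w : ℝ × Rn n ↦ ENNReal.ofReal (w.1 ^ (a / 2 - 1) *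
              heatKernel n w.1 (x - w.2)) :=
            ENNReal.measurable_ofReal.comp ((measurable_fst.pow_const _).mul h2)
          have h4 : AEMeasurable (fun w : ℝ × Rn n ↦ ‖q w.2‖ₑ)
              ((volume.restrict (Set.Ioi 0)).prod volume) :=
            (hq.comp_quasiMeasurePreserving Measure.quasiMeasurePreserving_snd).enorm
          exact h3.aemeasurable.mul h4
    _ ≤ ∫⁻ y, C * (pw (a - n) (x - y) * ‖q y‖ₑ) := by
        refine lintegral_mono_ae ?_
        have : ∀ᵐ y : Rn n, y ≠ x := by simp [ae_iff]
        filter_upwards [this] with y hy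
        rw [← mul_assoc]
        gcongr
        exact h _ (sub_ne_zero.2 hy.symm)
    _ = _ := lintegral_const_mul' _ _ hC.ne

/-- The convolution with the heat kernel on the Fourier side. -/
theorem integral_heatKernel_mul {t : ℝ} (ht : 0 < t) (u : 𝓢(Rn n, ℂ)) (x : Rn n) :
    ∫ ξ, ((Real.exp (-(t * (1 + ‖(2 * Real.pi) • ξ‖ ^ 2))) : ℝ) : ℂ) *
      (Complex.exp ((2 * Real.pi * inner ℝ ξ x : ℝ) * Complex.I) * 𝓕 u ξ) =
      (Real.exp (-t) : ℂ) * ∫ y, (heatKernel n t (x - y) : ℂ) * u y := by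
  set b : ℂ := ((4 * Real.pi ^ 2 * t : ℝ) : ℂ) with hbdef
  have hb : 0 < b.re := by rw [hbdef, Complex.ofReal_re]; positivity
  -- A Gaussian carrying the phase of Fourier inversion at x. Its Fourier transform is the heat
  -- kernel centred at x, and the transform is then moved from γ to u.
  let γ : Rn n → ℂ := fun v ↦
    Complex.exp (-b * ‖v‖ ^ 2 + 2 * Real.pi * Complex.I * (inner ℝ x v : ℝ))
  have hγ : Integrable γ volume := GaussianFourier.integrable_cexp_neg_mul_sq_norm_add hb _ x
  have hγF : ∀ w, 𝓕 γ w = (heatKernel n t (x - w) : ℂ) := by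
    intro w
    rw [fourier_gaussian_innerProductSpace' hb, finrank_euclideanSpace_fin, heatKernel]
    have e1 : (Real.pi : ℂ) / b = ((4 * Real.pi * t : ℝ) : ℂ)⁻¹ := by
      rw [hbdef, ← Complex.ofReal_div, ← Complex.ofReal_inv]
      congr 1
      field_simp
    rw [e1, Complex.ofReal_mul (_ ^ _), Complex.ofReal_cpow (by positivity)]
    have e2 : (((-(n : ℝ) / 2 : ℝ)) : ℂ) = -((n : ℂ) / 2) := by push_cast; ring
    rw [e2, Complex.cpow_neg, Complex.inv_cpow]
    · congr 1
      rw [Complex.ofReal_exp]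
      congr 1
      rw [hbdef]
      push_cast
      have : (Real.pi : ℂ) ≠ 0 := by exact_mod_cast Real.pi_ne_zero
      field_simp
    · rw [Complex.arg_ofReal_of_nonneg (by positivity)]
      exact Real.pi_pos.ne
  have hswap : ∫ w, 𝓕 γ w * u w = ∫ ξ, γ ξ * 𝓕 u ξ := by
    have := VectorFourier.integral_fourierIntegral_smul_eq_flip (L := innerₗ (Rn n))
      Real.continuous_fourierChar continuous_inner hγ
      (u.integrable (μ := volume))
    simpa [SchwartzMap.fourier_coe] using! this
  simp only [hγF] at hswap
  rw [hswap, ← integral_const_mul]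
  refine integral_congr_ae (Filter.Eventually.of_forall fun ξ ↦ ?_)
  simp only [γ]
  rw [← mul_assoc, ← mul_assoc, Complex.ofReal_exp, Complex.ofReal_exp, ← Complex.exp_add,
    ← Complex.exp_add, real_inner_comm ξ x, norm_smul, Real.norm_of_nonneg (by positivity)]
  congr 2
  rw [hbdef]
  push_cast
  ring

/-- Fubini for superpositions of Fourier multipliers. As k is nonnegative, absolute integrability
reduces to that of m‖G‖. -/
theorem integral_kernel_swap {k : ℝ → Rn n → ℝ} (hk : Measurable fun w : ℝ × Rn n ↦ k w.1 w.2)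
    (hk0 : ∀ t, 0 < t → ∀ ξ, 0 ≤ k t ξ)
    (hki : ∀ ξ, IntegrableOn (fun t ↦ k t ξ) (Set.Ioi 0)) {m : Rn n → ℝ}
    (hm : ∀ ξ, ∫ t in Set.Ioi (0 : ℝ), k t ξ = m ξ) {G : Rn n → ℂ}
    (hG : AEStronglyMeasurable G volume) (hi : Integrable (fun ξ ↦ m ξ * ‖G ξ‖) volume) :
    IntegrableOn (fun t ↦ ∫ ξ, (k t ξ : ℂ) * G ξ) (Set.Ioi 0) ∧
      ∫ t in Set.Ioi (0 : ℝ), ∫ ξ, (k t ξ : ℂ) * G ξ = ∫ ξ, (m ξ : ℂ) * G ξ := by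
  have hint : Integrable (fun w : ℝ × Rn n ↦ (k w.1 w.2 : ℂ) * G w.2)
      ((volume.restrict (Set.Ioi 0)).prod volume) := by
    have hmeas : AEStronglyMeasurable (fun w : ℝ × Rn n ↦ (k w.1 w.2 : ℂ) * G w.2)
        ((volume.restrict (Set.Ioi 0)).prod volume) :=
      (Complex.measurable_ofReal.comp hk).aestronglyMeasurable.mul hG.comp_snd
    rw [integrable_prod_iff' hmeas]
    refine ⟨Filter.Eventually.of_forall fun ξ ↦ (hki ξ).ofReal.mul_const (G ξ), ?_⟩
    refine hi.congr (Filter.Eventually.of_forall fun ξ ↦ ?_)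
    simp only [norm_mul]
    rw [integral_mul_const, ← hm]
    congr 1
    refine setIntegral_congr_fun measurableSet_Ioi fun t ht ↦ ?_
    simp only [Complex.norm_real]
    rw [Real.norm_of_nonneg (hk0 t ht ξ)]
  refine ⟨hint.integral_prod_left, ?_⟩
  rw [integral_integral_swap hint]
  refine integral_congr_ae (Filter.Eventually.of_forall fun ξ ↦ ?_)
  simp only
  rw [integral_mul_const, integral_complex_ofReal, hm]

theorem integrable_const_mul_japSymbol (s A : ℝ) (u : 𝓢(Rn n, ℂ)) (x : Rn n) :
    Integrable (fun ξ : Rn n ↦ A * (1 + ‖(2 * Real.pi) • ξ‖ ^ 2) ^ (s / 2) *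
      ‖Complex.exp ((2 * Real.pi * inner ℝ ξ x : ℝ) * Complex.I) * 𝓕 u ξ‖) volume := by
  refine (((𝓕 (japS n s u)).integrable (μ := volume)).norm.const_mul A).congr
    (Filter.Eventually.of_forall fun ξ ↦ ?_)
  simp only
  rw [fourier_japS, norm_mul, norm_mul, Complex.norm_exp_ofReal_mul_I, one_mul, norm_japSymbol,
    mul_assoc]

theorem aestronglyMeasurable_exp_mul_fourier (u : 𝓢(Rn n, ℂ)) (x : Rn n) :
    AEStronglyMeasurable (fun ξ : Rn n ↦
      Complex.exp ((2 * Real.pi * inner ℝ ξ x : ℝ) * Complex.I) * 𝓕 u ξ) volume := by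
  have h1 : Continuous fun ξ : Rn n ↦
      Complex.exp ((2 * Real.pi * inner ℝ ξ x : ℝ) * Complex.I) := by
    fun_prop
  exact (h1.mul (𝓕 u).continuous).aestronglyMeasurable

theorem integral_const_mul_japSymbol (s A : ℝ) (u : 𝓢(Rn n, ℂ)) (x : Rn n) :
    ∫ ξ : Rn n, ((A * (1 + ‖(2 * Real.pi) • ξ‖ ^ 2) ^ (s / 2) : ℝ) : ℂ) *
      (Complex.exp ((2 * Real.pi * inner ℝ ξ x : ℝ) * Complex.I) * 𝓕 u ξ) = A * japS n s u x := by
  rw [japS_apply, ← integral_const_mul]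
  refine integral_congr_ae (Filter.Eventually.of_forall fun ξ ↦ ?_)
  simp only [japSymbol]
  push_cast
  ring

/-- The Bessel potential as a superposition of heat kernels. -/
theorem integral_heat_eq_japS_neg {s : ℝ} (hs : 0 < s) (u : 𝓢(Rn n, ℂ)) (x : Rn n) :
    ∫ t in Set.Ioi (0 : ℝ), ((t ^ (s / 2 - 1) * Real.exp (-t) : ℝ) : ℂ) *
      ∫ y, (heatKernel n t (x - y) : ℂ) * u y = Real.Gamma (s / 2) * japS n (-s) u x := by
  have h := integral_kernel_swap (n := n)
    (k := fun t ξ ↦ t ^ (s / 2 - 1) * Real.exp (-((1 + ‖(2 * Real.pi) • ξ‖ ^ 2) * t)))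
    (m := fun ξ ↦ Real.Gamma (s / 2) * (1 + ‖(2 * Real.pi) • ξ‖ ^ 2) ^ (-s / 2))
    (by fun_prop) (fun t ht ξ ↦ by positivity)
    (fun ξ ↦ integrableOn_rpow_mul_exp_neg_mul (by linarith) (by positivity))
    (fun ξ ↦ by
      rw [Real.integral_rpow_mul_exp_neg_mul_Ioi (by linarith) (by positivity), one_div,
        Real.inv_rpow (by positivity), ← Real.rpow_neg (by positivity), mul_comm]
      congr 2
      ring)
    (aestronglyMeasurable_exp_mul_fourier u x) (integrable_const_mul_japSymbol _ _ u x)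
  rw [← integral_const_mul_japSymbol, ← h.2]
  refine setIntegral_congr_fun measurableSet_Ioi fun t ht ↦ ?_
  beta_reduce
  rw [Complex.ofReal_mul, mul_assoc, ← integral_heatKernel_mul ht, ← integral_const_mul]
  refine integral_congr_ae (Filter.Eventually.of_forall fun ξ ↦ ?_)
  simp only
  rw [mul_comm t (1 + _)]
  push_cast
  ring

/-- Near zero 1 - e^{-t} ≤ t and s < 2 suffice; at infinity s > 0 does. -/
theorem integrableOn_rpow_mul_one_sub_exp {s : ℝ} (hs : 0 < s) (hs2 : s < 2) :
    IntegrableOn (fun t : ℝ ↦ t ^ (-s / 2 - 1) * (1 - Real.exp (-t))) (Set.Ioi 0) := by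
  rw [← Set.Ioc_union_Ioi_eq_Ioi (zero_le_one' ℝ)]
  have hmeas : Measurable (fun t : ℝ ↦ t ^ (-s / 2 - 1) * (1 - Real.exp (-t))) := by fun_prop
  refine IntegrableOn.union ?_ ?_
  · have h1 : IntegrableOn (fun t : ℝ ↦ t ^ (-s / 2)) (Set.Ioc 0 1) := by
      rw [← intervalIntegrable_iff_integrableOn_Ioc_of_le zero_le_one]
      exact intervalIntegral.intervalIntegrable_rpow' (by linarith)
    refine Integrable.mono' h1 hmeas.aestronglyMeasurable ?_
    filter_upwards [ae_restrict_mem measurableSet_Ioc] with t ht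
    have ht0 : 0 < t := ht.1
    have h2 : Real.exp (-t) ≤ 1 := Real.exp_le_one_iff.2 (by linarith)
    have h3 : 1 - Real.exp (-t) ≤ t := by linarith [Real.add_one_le_exp (-t)]
    rw [Real.norm_of_nonneg (mul_nonneg (by positivity) (by linarith))]
    calc _ ≤ t ^ (-s / 2 - 1) * t := by gcongr
      _ = t ^ (-s / 2) := by
        rw [← Real.rpow_add_one ht0.ne']
        congr 1
        ring
  · refine Integrable.mono' (integrableOn_Ioi_rpow_of_lt (a := -s / 2 - 1) (by linarith) one_pos)
      hmeas.aestronglyMeasurable ?_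
    filter_upwards [ae_restrict_mem measurableSet_Ioi] with t ht
    have ht0 : 0 < t := one_pos.trans ht
    have h2 : Real.exp (-t) ≤ 1 := Real.exp_le_one_iff.2 (by linarith)
    rw [Real.norm_of_nonneg (mul_nonneg (by positivity) (by linarith))]
    exact mul_le_of_le_one_right (by positivity) (by linarith [Real.exp_pos (-t)])

theorem integral_rpow_mul_one_sub_exp_pos {s : ℝ} (hs : 0 < s) (hs2 : s < 2) :
    0 < ∫ t in Set.Ioi (0 : ℝ), t ^ (-s / 2 - 1) * (1 - Real.exp (-t)) := by
  have hpos : ∀ t : ℝ, 0 < t → 0 < t ^ (-s / 2 - 1) * (1 - Real.exp (-t)) := fun t ht ↦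
    mul_pos (by positivity) (by linarith [Real.exp_lt_one_iff.2 (show -t < 0 by linarith)])
  rw [setIntegral_pos_iff_support_of_nonneg_ae]
  · have : Set.Ioi (0 : ℝ) ⊆ (Function.support fun t : ℝ ↦
        t ^ (-s / 2 - 1) * (1 - Real.exp (-t))) ∩ Set.Ioi 0 :=
      fun t ht ↦ ⟨(hpos t ht).ne', ht⟩
    refine lt_of_lt_of_le ?_ (measure_mono this)
    simp
  · filter_upwards [ae_restrict_mem measurableSet_Ioi] with t ht
    exact (hpos t ht).le
  · exact integrableOn_rpow_mul_one_sub_exp hs hs2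

theorem rpow_mul_one_sub_exp_scale {s r t : ℝ} (hr : 0 < r) (ht : 0 < t) :
    r ^ (s / 2 + 1) * ((r * t) ^ (-s / 2 - 1) * (1 - Real.exp (-(r * t)))) =
      t ^ (-s / 2 - 1) * (1 - Real.exp (-(r * t))) := by
  rw [Real.mul_rpow hr.le ht.le, ← mul_assoc, ← mul_assoc, ← Real.rpow_add hr]
  have : s / 2 + 1 + (-s / 2 - 1) = 0 := by ring
  rw [this, Real.rpow_zero, one_mul]

theorem integrableOn_rpow_mul_one_sub_exp_mul {s r : ℝ} (hs : 0 < s) (hs2 : s < 2) (hr : 0 < r) :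
    IntegrableOn (fun t : ℝ ↦ t ^ (-s / 2 - 1) * (1 - Real.exp (-(r * t)))) (Set.Ioi 0) := by
  have h := (integrableOn_Ioi_comp_mul_left_iff
    (fun t : ℝ ↦ t ^ (-s / 2 - 1) * (1 - Real.exp (-t))) 0 hr).2
    (by rw [mul_zero]; exact integrableOn_rpow_mul_one_sub_exp hs hs2)
  exact IntegrableOn.congr_fun (h.const_mul (r ^ (s / 2 + 1)))
    (fun t ht ↦ rpow_mul_one_sub_exp_scale hr ht) measurableSet_Ioi

theorem integral_rpow_mul_one_sub_exp_mul {s r : ℝ} (hr : 0 < r) :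
    ∫ t in Set.Ioi (0 : ℝ), t ^ (-s / 2 - 1) * (1 - Real.exp (-(r * t))) =
      (∫ t in Set.Ioi (0 : ℝ), t ^ (-s / 2 - 1) * (1 - Real.exp (-t))) * r ^ (s / 2) := by
  have h := integral_comp_mul_left_Ioi
    (fun t : ℝ ↦ t ^ (-s / 2 - 1) * (1 - Real.exp (-t))) 0 hr
  rw [mul_zero, smul_eq_mul] at h
  rw [← setIntegral_congr_fun measurableSet_Ioi
    (fun t ht ↦ rpow_mul_one_sub_exp_scale (s := s) hr ht), integral_const_mul, h, ← mul_assoc,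
    mul_comm, Real.rpow_add_one hr.ne', mul_assoc, mul_inv_cancel₀ hr.ne', mul_one]

/-- The fractional derivative as a superposition of heat kernels. -/
theorem exists_integral_heat_eq_japS (n : ℕ) {s : ℝ} (hs : 0 < s) (hs2 : s < 2) :
    ∃ A : ℝ, 0 < A ∧ ∀ (u : 𝓢(Rn n, ℂ)) (x : Rn n),
      IntegrableOn (fun t : ℝ ↦ ((t ^ (-s / 2 - 1) : ℝ) : ℂ) * (u x - (Real.exp (-t) : ℂ) *
        ∫ y, (heatKernel n t (x - y) : ℂ) * u y)) (Set.Ioi 0) ∧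
      ∫ t in Set.Ioi (0 : ℝ), ((t ^ (-s / 2 - 1) : ℝ) : ℂ) * (u x - (Real.exp (-t) : ℂ) *
        ∫ y, (heatKernel n t (x - y) : ℂ) * u y) = A * japS n s u x := by
  refine ⟨_, integral_rpow_mul_one_sub_exp_pos hs hs2, fun u x ↦ ?_⟩
  set A := ∫ t in Set.Ioi (0 : ℝ), t ^ (-s / 2 - 1) * (1 - Real.exp (-t)) with hA
  have h := integral_kernel_swap (n := n)
    (k := fun t ξ ↦ t ^ (-s / 2 - 1) * (1 - Real.exp (-((1 + ‖(2 * Real.pi) • ξ‖ ^ 2) * t))))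
    (m := fun ξ ↦ A * (1 + ‖(2 * Real.pi) • ξ‖ ^ 2) ^ (s / 2))
    (by fun_prop) (fun t ht ξ ↦ mul_nonneg (by positivity) (sub_nonneg.2
      (Real.exp_le_one_iff.2 (neg_nonpos.2 (by positivity)))))
    (fun ξ ↦ integrableOn_rpow_mul_one_sub_exp_mul hs hs2 (by positivity))
    (fun ξ ↦ integral_rpow_mul_one_sub_exp_mul (by positivity))
    (aestronglyMeasurable_exp_mul_fourier u x) (integrable_const_mul_japSymbol _ _ u x)
  have hu : u x = ∫ ξ, Complex.exp ((2 * Real.pi * inner ℝ ξ x : ℝ) * Complex.I) * 𝓕 u ξ := by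
    have := japS_apply 0 u x
    rw [japS_zero] at this
    simpa [japSymbol_zero] using this
  have hG : Integrable (fun ξ : Rn n ↦
      Complex.exp ((2 * Real.pi * inner ℝ ξ x : ℝ) * Complex.I) * 𝓕 u ξ) volume := by
    refine ⟨aestronglyMeasurable_exp_mul_fourier u x, ?_⟩
    have := ((𝓕 u).integrable (μ := volume)).2
    refine this.mono (Filter.Eventually.of_forall fun ξ ↦ ?_)
    rw [norm_mul, Complex.norm_exp_ofReal_mul_I, one_mul]
  have e : ∀ t ∈ Set.Ioi (0 : ℝ), ∫ ξ, ((t ^ (-s / 2 - 1) *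
      (1 - Real.exp (-((1 + ‖(2 * Real.pi) • ξ‖ ^ 2) * t))) : ℝ) : ℂ) *
      (Complex.exp ((2 * Real.pi * inner ℝ ξ x : ℝ) * Complex.I) * 𝓕 u ξ) =
      ((t ^ (-s / 2 - 1) : ℝ) : ℂ) * (u x - (Real.exp (-t) : ℂ) *
        ∫ y, (heatKernel n t (x - y) : ℂ) * u y) := by
    intro t ht
    have ht : 0 < t := ht
    rw [← integral_heatKernel_mul ht, hu, ← integral_sub hG, ← integral_const_mul]
    · refine integral_congr_ae (Filter.Eventually.of_forall fun ξ ↦ ?_)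
      simp only
      rw [mul_comm t (1 + _)]
      push_cast
      ring
    · refine hG.bdd_mul (c := 1) ?_ (Filter.Eventually.of_forall fun ξ ↦ ?_)
      · have : Continuous fun ξ : Rn n ↦
            ((Real.exp (-(t * (1 + ‖(2 * Real.pi) • ξ‖ ^ 2))) : ℝ) : ℂ) := by fun_prop
        exact this.aestronglyMeasurable
      · rw [Complex.norm_real, Real.norm_of_nonneg (Real.exp_pos _).le]
        exact Real.exp_le_one_iff.2 (neg_nonpos.2 (by positivity))
  rw [integral_const_mul_japSymbol, setIntegral_congr_fun measurableSet_Ioi e] at h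
  exact ⟨h.1.congr_fun e measurableSet_Ioi, h.2⟩

/-- Pointwise bound of the Bessel potential by the Riesz potential. -/
theorem exists_enorm_japS_neg_le (hn : 2 ≤ n) {s : ℝ} (hs : 0 < s) (hsn : s < n) :
    ∃ C : ℝ≥0∞, C < ∞ ∧ ∀ (f : 𝓢(Rn n, ℂ)) (x : Rn n),
      ‖japS n (-s) f x‖ₑ ≤ C * ∫⁻ y, pw (s - n) (x - y) * ‖f y‖ₑ := by
  obtain ⟨C, hC, h⟩ := exists_lintegral_heat_le hn hsn
  have hΓ : 0 < Real.Gamma (s / 2) := Real.Gamma_pos_of_pos (by linarith)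
  refine ⟨ENNReal.ofReal (Real.Gamma (s / 2))⁻¹ * C, ENNReal.mul_lt_top ENNReal.ofReal_lt_top hC,
    fun f x ↦ ?_⟩
  have e : japS n (-s) f x = (((Real.Gamma (s / 2))⁻¹ : ℝ) : ℂ) *
      ∫ t in Set.Ioi (0 : ℝ), ((t ^ (s / 2 - 1) * Real.exp (-t) : ℝ) : ℂ) *
        ∫ y, (heatKernel n t (x - y) : ℂ) * f y := by
    rw [integral_heat_eq_japS_neg hs, ← mul_assoc, ← Complex.ofReal_mul, inv_mul_cancel₀ hΓ.ne',
      Complex.ofReal_one, one_mul]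
  rw [e, enorm_mul, mul_assoc]
  refine mul_le_mul' ?_ ((enorm_integral_le_lintegral_enorm _).trans
    (h x f f.continuous.aemeasurable))
  rw [← ofReal_norm, Complex.norm_real, Real.norm_of_nonneg (by positivity)]

theorem integrable_heatKernel_mul {t : ℝ} (ht : 0 < t) (u : 𝓢(Rn n, ℂ)) (x : Rn n) :
    Integrable (fun y ↦ (heatKernel n t (x - y) : ℂ) * u y) volume := by
  refine (u.integrable (μ := volume)).bdd_mul (c := (4 * Real.pi * t) ^ (-(n : ℝ) / 2)) ?_
    (Filter.Eventually.of_forall fun y ↦ ?_)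
  · have : Measurable fun y : Rn n ↦ (heatKernel n t (x - y) : ℂ) := by
      unfold heatKernel
      fun_prop
    exact this.aestronglyMeasurable
  · rw [Complex.norm_real, Real.norm_of_nonneg (heatKernel_nonneg ht _), heatKernel]
    exact mul_le_of_le_one_right (by positivity)
      (Real.exp_le_one_iff.2 (neg_nonpos.2 (by positivity)))

/-- Pointwise bound of the commutator of a fractional derivative with a multiplication. -/
theorem exists_enorm_commutator_le (hn : 2 ≤ n) {s : ℝ} (hs : 0 < s) (hs2 : s < 2) :
    ∃ C : ℝ≥0∞, C < ∞ ∧ ∀ (g : Rn n → ℂ) (u w : 𝓢(Rn n, ℂ)), Measurable g →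
      (∀ y, w y = g y * u y) → ∀ x : Rn n, ‖japS n s w x - g x * japS n s u x‖ₑ ≤
        C * ∫⁻ y, pw (-s - n) (x - y) * ‖(g x - g y) * u y‖ₑ := by
  have hn0 : (0 : ℝ) ≤ n := Nat.cast_nonneg n
  obtain ⟨C, hC, h⟩ := exists_lintegral_heat_le hn (a := -s) (by linarith)
  obtain ⟨A, hA, hrep⟩ := exists_integral_heat_eq_japS n hs hs2
  refine ⟨ENNReal.ofReal A⁻¹ * C, ENNReal.mul_lt_top ENNReal.ofReal_lt_top hC,
    fun g u w hg hw x ↦ ?_⟩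
  have hA' : (A : ℂ) ≠ 0 := by exact_mod_cast hA.ne'
  -- The local terms w(x) and g(x)u(x) cancel, leaving only the heat integral with the increment of
  -- g.
  have e : japS n s w x - g x * japS n s u x = ((A⁻¹ : ℝ) : ℂ) *
      ∫ t in Set.Ioi (0 : ℝ), ((t ^ (-s / 2 - 1) * Real.exp (-t) : ℝ) : ℂ) *
        ∫ y, (heatKernel n t (x - y) : ℂ) * ((g x - g y) * u y) := by
    have e1 : japS n s w x - g x * japS n s u x =
        ((A⁻¹ : ℝ) : ℂ) * (A * japS n s w x - g x * (A * japS n s u x)) := by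
      push_cast
      field_simp
    rw [e1, ← (hrep u x).2, ← (hrep w x).2, ← integral_const_mul,
      ← integral_sub (hrep w x).1 ((hrep u x).1.const_mul (g x))]
    congr 1
    refine setIntegral_congr_fun measurableSet_Ioi fun t ht ↦ ?_
    have e2 : ∫ y, (heatKernel n t (x - y) : ℂ) * ((g x - g y) * u y) =
        g x * (∫ y, (heatKernel n t (x - y) : ℂ) * u y) -
          ∫ y, (heatKernel n t (x - y) : ℂ) * w y := by
      rw [← integral_const_mul, ← integral_sub ((integrable_heatKernel_mul ht u x).const_mul _)
        (integrable_heatKernel_mul ht w x)]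
      refine integral_congr_ae (Filter.Eventually.of_forall fun y ↦ ?_)
      simp only [hw]
      ring
    simp only [e2, hw x]
    push_cast
    ring
  rw [e, enorm_mul, mul_assoc]
  refine mul_le_mul' ?_ ((enorm_integral_le_lintegral_enorm _).trans (h x _ ?_))
  · rw [← ofReal_norm, Complex.norm_real, Real.norm_of_nonneg (by positivity)]
  · exact ((measurable_const.sub hg).mul u.continuous.measurable).aemeasurable

/-! ### Power weights and convolution of Riesz kernels -/

theorem pw_mul_pw {a b : ℝ} {x : Rn n} (hx : x ≠ 0) : pw a x * pw b x = pw (a + b) x := by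
  rw [pw, pw, pw, ← ENNReal.ofReal_mul (by positivity), Real.rpow_add (norm_pos_iff.2 hx)]

theorem pw_rpow {a b : ℝ} (hb : 0 ≤ b) (x : Rn n) : pw a x ^ b = pw (a * b) x := by
  rw [pw, pw, ENNReal.ofReal_rpow_of_nonneg (by positivity) hb, Real.rpow_mul (norm_nonneg _)]

theorem pw_ne_top (a : ℝ) (x : Rn n) : pw a x ≠ ∞ := ENNReal.ofReal_ne_top

theorem pw_ne_zero {a : ℝ} {x : Rn n} (hx : x ≠ 0) : pw a x ≠ 0 := by
  rw [pw, ne_eq, ENNReal.ofReal_eq_zero, not_le]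
  exact Real.rpow_pos_of_pos (norm_pos_iff.2 hx) _

theorem pw_sub_comm (a : ℝ) (x y : Rn n) : pw a (x - y) = pw a (y - x) := by
  rw [pw, pw, norm_sub_rev]

theorem ae_ne (hn : 2 ≤ n) (x : Rn n) : ∀ᵐ y : Rn n, y ≠ x := by
  have : Nonempty (Fin n) := ⟨⟨0, by omega⟩⟩
  simp [ae_iff]

theorem lintegral_radial (hn : 2 ≤ n) {f : ℝ → ℝ} (hf : ∀ r, 0 ≤ r → 0 ≤ f r)
    (hi : IntegrableOn (fun y ↦ y ^ (n - 1) * f y) (Set.Ioi 0)) :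
    ∫⁻ x : Rn n, ENNReal.ofReal (f ‖x‖) = ENNReal.ofReal
      (n * volume.real (Metric.ball (0 : Rn n) 1) * ∫ y in Set.Ioi (0 : ℝ), y ^ (n - 1) * f y) := by
  have : Nonempty (Fin n) := ⟨⟨0, by omega⟩⟩
  have h1 : Integrable (fun x : Rn n ↦ f ‖x‖) volume := by
    rw [integrable_fun_norm_addHaar volume (f := f), finrank_euclideanSpace_fin]
    exact hi
  rw [← ofReal_integral_eq_lintegral_ofReal h1
    (Filter.Eventually.of_forall fun x ↦ hf _ (norm_nonneg _)), integral_fun_norm_addHaar,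
    finrank_euclideanSpace_fin]
  simp only [nsmul_eq_mul, smul_eq_mul, mul_assoc]

theorem exists_lintegral_pw_ball_le (hn : 2 ≤ n) {c : ℝ} (hc : c < n) :
    ∃ C : ℝ≥0∞, C < ∞ ∧ ∀ R : ℝ, 0 < R →
      ∫⁻ x : Rn n, (Metric.ball 0 R).indicator (pw (-c)) x ≤ C * ENNReal.ofReal (R ^ (n - c)) := by
  refine ⟨ENNReal.ofReal (n * volume.real (Metric.ball (0 : Rn n) 1) * (1 / (n - c))),
    ENNReal.ofReal_lt_top, fun R hR ↦ ?_⟩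
  have e1 : ∀ x : Rn n, (Metric.ball 0 R).indicator (pw (-c)) x =
      ENNReal.ofReal ((Set.Iio R).indicator (fun y : ℝ ↦ y ^ (-c)) ‖x‖) := by
    intro x
    by_cases hx : ‖x‖ < R
    · rw [Set.indicator_of_mem (by simpa using hx), Set.indicator_of_mem (by simpa using hx), pw]
    · rw [Set.indicator_of_notMem (by simpa using hx), Set.indicator_of_notMem (by simpa using hx),
        ENNReal.ofReal_zero]
  have e2 : Set.EqOn (fun y : ℝ ↦ y ^ (n - 1) * (Set.Iio R).indicator (fun y : ℝ ↦ y ^ (-c)) y)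
      ((Set.Iio R).indicator (fun y : ℝ ↦ y ^ ((n : ℝ) - 1 - c))) (Set.Ioi 0) := by
    intro y hy
    have hy : 0 < y := hy
    by_cases hx : y < R
    · simp only [Set.indicator_of_mem (show y ∈ Set.Iio R from hx)]
      rw [← Real.rpow_natCast, ← Real.rpow_add hy, Nat.cast_sub (by omega), Nat.cast_one,
        sub_eq_add_neg _ c]
    · simp [Set.indicator_of_notMem (show y ∉ Set.Iio R from hx)]
  have hint : IntegrableOn (fun y : ℝ ↦ y ^ ((n : ℝ) - 1 - c)) (Set.Ioc 0 R) := by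
    rw [← intervalIntegrable_iff_integrableOn_Ioc_of_le hR.le]
    exact intervalIntegral.intervalIntegrable_rpow' (by linarith)
  have hset : Set.Ioi (0 : ℝ) ∩ Set.Iio R = Set.Ioo 0 R := Set.Ioi_inter_Iio
  rw [lintegral_congr e1, lintegral_radial hn]
  · rw [setIntegral_congr_fun measurableSet_Ioi e2, setIntegral_indicator measurableSet_Iio, hset,
      ← integral_Ioc_eq_integral_Ioo, ← intervalIntegral.integral_of_le hR.le,
      integral_rpow (Or.inl (by linarith)), ← ENNReal.ofReal_mul (by
        have : 0 < (n : ℝ) - c := by linarith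
        positivity)]
    refine ENNReal.ofReal_le_ofReal (le_of_eq ?_)
    have : (n : ℝ) - 1 - c + 1 = n - c := by ring
    rw [this, Real.zero_rpow (by linarith)]
    ring
  · intro r hr
    exact Set.indicator_apply_nonneg fun _ ↦ by positivity
  · refine IntegrableOn.congr_fun ?_ (fun y hy ↦ (e2 hy).symm) measurableSet_Ioi
    rw [IntegrableOn, integrable_indicator_iff measurableSet_Iio, IntegrableOn,
      Measure.restrict_restrict measurableSet_Iio, Set.inter_comm, hset]
    exact hint.mono_set Set.Ioo_subset_Ioc_self

theorem exists_lintegral_pw_compl_ball_le (hn : 2 ≤ n) {d : ℝ} (hd : (n : ℝ) < d) :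
    ∃ C : ℝ≥0∞, C < ∞ ∧ ∀ R : ℝ, 0 < R →
      ∫⁻ x : Rn n, (Metric.ball 0 R)ᶜ.indicator (pw (-d)) x ≤
        C * ENNReal.ofReal (R ^ (n - d)) := by
  refine ⟨ENNReal.ofReal (n * volume.real (Metric.ball (0 : Rn n) 1) * (1 / (d - n))),
    ENNReal.ofReal_lt_top, fun R hR ↦ ?_⟩
  have e1 : ∀ x : Rn n, (Metric.ball 0 R)ᶜ.indicator (pw (-d)) x =
      ENNReal.ofReal ((Set.Ici R).indicator (fun y : ℝ ↦ y ^ (-d)) ‖x‖) := by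
    intro x
    by_cases hx : ‖x‖ < R
    · rw [Set.indicator_of_notMem (by simpa using hx), Set.indicator_of_notMem (by simpa using hx),
        ENNReal.ofReal_zero]
    · rw [Set.indicator_of_mem (by simpa using hx), Set.indicator_of_mem (by simpa using hx), pw]
  have e2 : Set.EqOn (fun y : ℝ ↦ y ^ (n - 1) * (Set.Ici R).indicator (fun y : ℝ ↦ y ^ (-d)) y)
      ((Set.Ici R).indicator (fun y : ℝ ↦ y ^ ((n : ℝ) - 1 - d))) (Set.Ioi 0) := by
    intro y hy
    have hy : 0 < y := hy
    by_cases hx : R ≤ y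
    · simp only [Set.indicator_of_mem (show y ∈ Set.Ici R from hx)]
      rw [← Real.rpow_natCast, ← Real.rpow_add hy, Nat.cast_sub (by omega), Nat.cast_one,
        sub_eq_add_neg _ d]
    · simp [Set.indicator_of_notMem (show y ∉ Set.Ici R from hx)]
  have hset : Set.Ioi (0 : ℝ) ∩ Set.Ici R = Set.Ici R :=
    Set.inter_eq_right.2 fun y hy ↦ hR.trans_le hy
  rw [lintegral_congr e1, lintegral_radial hn]
  · rw [setIntegral_congr_fun measurableSet_Ioi e2, setIntegral_indicator measurableSet_Ici, hset,
      integral_Ici_eq_integral_Ioi, integral_Ioi_rpow_of_lt (by linarith) hR,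
      ← ENNReal.ofReal_mul (by
        have : 0 < d - n := by linarith
        positivity)]
    refine ENNReal.ofReal_le_ofReal (le_of_eq ?_)
    have : (n : ℝ) - 1 - d + 1 = n - d := by ring
    rw [this, ← neg_sub d n, neg_div_neg_eq]
    ring
  · intro r hr
    exact Set.indicator_apply_nonneg fun _ ↦ by positivity
  · refine IntegrableOn.congr_fun ?_ (fun y hy ↦ (e2 hy).symm) measurableSet_Ioi
    rw [IntegrableOn, integrable_indicator_iff measurableSet_Ici, IntegrableOn,
      Measure.restrict_restrict measurableSet_Ici, Set.inter_comm, hset]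
    exact (integrableOn_Ici_iff_integrableOn_Ioi (by simp)).2
      (integrableOn_Ioi_rpow_of_lt (by linarith) hR)

/-- The convolution of two Riesz kernels. -/
theorem exists_lintegral_pw_mul_pw_le (hn : 2 ≤ n) {a c : ℝ} (ha : 0 < a) (hac : a < c)
    (hc : c < n) :
    ∃ C : ℝ≥0∞, C < ∞ ∧ ∀ x : Rn n, x ≠ 0 →
      ∫⁻ y, pw (a - n) (x - y) * pw (-c) y ≤ C * pw (a - c) x := by
  obtain ⟨C₁, hC₁, h₁⟩ := exists_lintegral_pw_ball_le hn hc
  obtain ⟨C₂, hC₂, h₂⟩ := exists_lintegral_pw_ball_le hn (c := n - a) (by linarith)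
  obtain ⟨C₃, hC₃, h₃⟩ := exists_lintegral_pw_compl_ball_le hn (d := n + c - a) (by linarith)
  refine ⟨(C₁ + C₂ + ENNReal.ofReal (3 ^ (n - a)) * C₃) * ENNReal.ofReal (2 ^ (c - a)),
    ENNReal.mul_lt_top (ENNReal.add_lt_top.2 ⟨ENNReal.add_lt_top.2 ⟨hC₁, hC₂⟩,
      ENNReal.mul_lt_top ENNReal.ofReal_lt_top hC₃⟩) ENNReal.ofReal_lt_top, fun x hx ↦ ?_⟩
  have hx0 : 0 < ‖x‖ := norm_pos_iff.2 hx
  set R := ‖x‖ / 2 with hR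
  have hR0 : 0 < R := by positivity
  -- Three regions: |y| < R, where |x-y| ≥ R; |x-y| < R, where |y| ≥ R; and the rest, where |y| ≤
  -- 3|x-y| and the integrand is at most a multiple of |y|^{-(n+c-a)}, integrable at infinity
  -- because a < c.
  have hpt : ∀ y : Rn n, pw (a - n) (x - y) * pw (-c) y ≤
      ENNReal.ofReal (R ^ (a - n)) * (Metric.ball 0 R).indicator (pw (-c)) y +
      ENNReal.ofReal (R ^ (-c)) * (Metric.ball 0 R).indicator (pw (-(n - a))) (x - y) +
      ENNReal.ofReal (3 ^ (n - a)) * (Metric.ball 0 R)ᶜ.indicator (pw (-(n + c - a))) y := by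
    intro y
    have htri : ‖x‖ ≤ ‖x - y‖ + ‖y‖ := by simpa using norm_add_le (x - y) y
    have htri' : ‖y‖ ≤ ‖x - y‖ + ‖x‖ := by
      have := norm_sub_le x (x - y)
      rw [sub_sub_cancel] at this
      linarith
    by_cases hy : ‖y‖ < R
    · rw [Set.indicator_of_mem (by simpa using hy) (pw (-c)), add_assoc]
      refine le_trans ?_ le_self_add
      gcongr
      rw [pw]
      refine ENNReal.ofReal_le_ofReal ?_
      exact Real.rpow_le_rpow_of_nonpos hR0 (by linarith) (by linarith)
    · by_cases hxy : ‖x - y‖ < R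
      · rw [Set.indicator_of_mem (by simpa using hxy) (pw (-(n - a)))]
        refine le_trans ?_ (le_self_add.trans' le_add_self)
        rw [mul_comm, neg_sub]
        gcongr
        rw [pw]
        refine ENNReal.ofReal_le_ofReal ?_
        exact Real.rpow_le_rpow_of_nonpos hR0 (by linarith) (by linarith)
      · rw [Set.indicator_of_mem (by simpa using hy) (pw (-(n + c - a)))]
        refine le_trans ?_ le_add_self
        have hy0 : 0 < ‖y‖ := hR0.trans_le (not_lt.1 hy)
        have : -(n + c - a) = (a - n) + -c := by ring
        rw [this, ← pw_mul_pw (norm_pos_iff.1 hy0), ← mul_assoc]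
        gcongr
        rw [pw, pw, ← ENNReal.ofReal_mul (by positivity)]
        refine ENNReal.ofReal_le_ofReal ?_
        calc ‖x - y‖ ^ (a - n) ≤ (‖y‖ / 3) ^ (a - n) :=
              Real.rpow_le_rpow_of_nonpos (by positivity) (by linarith) (by linarith)
          _ = 3 ^ (n - a) * ‖y‖ ^ (a - n) := by
            rw [Real.div_rpow hy0.le (by norm_num), ← neg_sub (n : ℝ) a,
              Real.rpow_neg (by norm_num : (0 : ℝ) ≤ 3)]
            field_simp
  have hm1 : Measurable ((Metric.ball (0 : Rn n) R).indicator (pw (-c))) :=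
    (measurable_pw _).indicator measurableSet_ball
  have hm2 : Measurable ((Metric.ball (0 : Rn n) R).indicator (pw (-(n - a)))) :=
    (measurable_pw _).indicator measurableSet_ball
  have hm2' : Measurable fun y ↦ (Metric.ball (0 : Rn n) R).indicator (pw (-(n - a))) (x - y) :=
    hm2.comp (measurable_const.sub measurable_id)
  have hm12 : Measurable fun y ↦
      ENNReal.ofReal (R ^ (a - n)) * (Metric.ball (0 : Rn n) R).indicator (pw (-c)) y +
      ENNReal.ofReal (R ^ (-c)) * (Metric.ball (0 : Rn n) R).indicator (pw (-(n - a))) (x - y) :=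
    (hm1.const_mul _).add (hm2'.const_mul _)
  refine (lintegral_mono hpt).trans ?_
  rw [lintegral_add_left hm12,
    lintegral_add_left (hm1.const_mul _), lintegral_const_mul' _ _ ENNReal.ofReal_ne_top,
    lintegral_const_mul' _ _ ENNReal.ofReal_ne_top, lintegral_const_mul' _ _ ENNReal.ofReal_ne_top,
    lintegral_sub_left_eq_self (fun y ↦ (Metric.ball (0 : Rn n) R).indicator (pw (-(n - a))) y)]
  have e : pw (a - c) x * ENNReal.ofReal (2 ^ (c - a)) = ENNReal.ofReal (R ^ (a - c)) := by
    rw [pw, ← ENNReal.ofReal_mul (by positivity), hR, Real.div_rpow hx0.le (by norm_num),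
      ← neg_sub c a, Real.rpow_neg (by norm_num : (0 : ℝ) ≤ 2), div_inv_eq_mul]
  rw [mul_right_comm, mul_assoc, e]
  have r1 : R ^ (a - n) * R ^ (n - c) = R ^ (a - c) := by
    rw [← Real.rpow_add hR0]; congr 1; ring
  have r2 : R ^ (-c) * R ^ (n - (n - a)) = R ^ (a - c) := by
    rw [← Real.rpow_add hR0]; congr 1; ring
  have r3 : R ^ (n - (n + c - a)) = R ^ (a - c) := by congr 1; ring
  calc _ ≤ ENNReal.ofReal (R ^ (a - n)) * (C₁ * ENNReal.ofReal (R ^ (n - c))) +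
        ENNReal.ofReal (R ^ (-c)) * (C₂ * ENNReal.ofReal (R ^ (n - (n - a)))) +
        ENNReal.ofReal (3 ^ (n - a)) * (C₃ * ENNReal.ofReal (R ^ (n - (n + c - a)))) := by
        gcongr
        · exact h₁ R hR0
        · exact h₂ R hR0
        · exact h₃ R hR0
    _ = C₁ * (ENNReal.ofReal (R ^ (a - n) * R ^ (n - c))) +
        C₂ * (ENNReal.ofReal (R ^ (-c) * R ^ (n - (n - a)))) +
        ENNReal.ofReal (3 ^ (n - a)) * C₃ * ENNReal.ofReal (R ^ (n - (n + c - a))) := by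
        rw [ENNReal.ofReal_mul (by positivity), ENNReal.ofReal_mul (by positivity)]
        ring
    _ = (C₁ + C₂ + ENNReal.ofReal (3 ^ (n - a)) * C₃) * ENNReal.ofReal (R ^ (a - c)) := by
        rw [r1, r2, r3]
        ring
    _ ≤ _ := le_of_eq (by ring)

/-! ### Schur's test and Hardy inequalities -/

/-- Schur's test with a weight. -/
theorem lintegral_rpow_le_of_schur {α : Type*} [MeasurableSpace α] {μ : Measure α} [SFinite μ]
    {p q : ℝ} (hpq : p.HolderConjugate q) {K : α → α → ℝ≥0∞}
    (hK : Measurable fun w : α × α ↦ K w.1 w.2) {φ : α → ℝ≥0∞} (hφ : Measurable φ)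
    (hφ0 : ∀ᵐ x ∂μ, φ x ≠ 0) (hφt : ∀ᵐ x ∂μ, φ x ≠ ∞) {A B : ℝ≥0∞}
    (h₁ : ∀ᵐ x ∂μ, ∫⁻ y, K x y * φ y ∂μ ≤ A * φ x)
    (h₂ : ∀ᵐ y ∂μ, ∫⁻ x, K x y * φ x ^ (p - 1) ∂μ ≤ B * φ y ^ (p - 1))
    {f : α → ℝ≥0∞} (hf : Measurable f) :
    ∫⁻ x, (∫⁻ y, K x y * f y ∂μ) ^ p ∂μ ≤ A ^ (p - 1) * B * ∫⁻ y, f y ^ p ∂μ := by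
  have hp0 : 0 < p := hpq.pos
  have hq0 : 0 < q := hpq.symm.pos
  have hp1 : 0 < p - 1 := hpq.sub_one_pos
  have hKx : ∀ x, Measurable (K x) := fun x ↦ hK.comp (measurable_const.prodMk measurable_id)
  have hpq1 : 1 / q * p = p - 1 := by rw [one_div_mul_eq_div, hpq.div_conj_eq_sub_one]
  have hpoint : ∀ᵐ x ∂μ, (∫⁻ y, K x y * f y ∂μ) ^ p ≤
      A ^ (p - 1) * ∫⁻ y, φ x ^ (p - 1) * (K x y * (φ y ^ (-(p - 1)) * f y ^ p)) ∂μ := by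
    filter_upwards [h₁] with x hx
    -- The splitting Kf = (Kφ)^{1/q} (Kφ^{-(p-1)} f^p)^{1/p} prepares Hölder's inequality.
    have e : ∫⁻ y, K x y * f y ∂μ = ∫⁻ y, (fun y ↦ (K x y * φ y) ^ (1 / q)) y *
        (fun y ↦ (K x y * (φ y ^ (-(p - 1)) * f y ^ p)) ^ (1 / p)) y ∂μ := by
      refine lintegral_congr_ae ?_
      filter_upwards [hφ0, hφt] with y hy0 hyt
      rw [ENNReal.mul_rpow_of_nonneg _ _ (by positivity),
        ENNReal.mul_rpow_of_nonneg _ _ (by positivity),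
        ENNReal.mul_rpow_of_nonneg _ _ (by positivity), ← ENNReal.rpow_mul, ← ENNReal.rpow_mul,
        mul_one_div_cancel hp0.ne', ENNReal.rpow_one]
      have e1 : K x y ^ (1 / q) * K x y ^ (1 / p) = K x y := by
        rw [← ENNReal.rpow_add_of_nonneg _ _ (by positivity) (by positivity),
          hpq.symm.one_div_add_one_div, one_div_one, ENNReal.rpow_one]
      have e2 : φ y ^ (1 / q) * φ y ^ (-(p - 1) * (1 / p)) = 1 := by
        rw [← ENNReal.rpow_add _ _ hy0 hyt]
        have : 1 / q + -(p - 1) * (1 / p) = 0 := by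
          rw [← hpq1]
          field_simp
          ring
        rw [this, ENNReal.rpow_zero]
      calc K x y * f y = (K x y ^ (1 / q) * K x y ^ (1 / p)) *
            (φ y ^ (1 / q) * φ y ^ (-(p - 1) * (1 / p))) * f y := by rw [e1, e2, mul_one]
        _ = _ := by ring
    rw [e]
    have hH := ENNReal.lintegral_mul_le_Lp_mul_Lq μ hpq.symm
      (f := fun y ↦ (K x y * φ y) ^ (1 / q))
      (g := fun y ↦ (K x y * (φ y ^ (-(p - 1)) * f y ^ p)) ^ (1 / p))
      (((hKx x).mul hφ).pow_const _).aemeasurable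
      (((hKx x).mul ((hφ.pow_const _).mul (hf.pow_const _))).pow_const _).aemeasurable
    simp only [← ENNReal.rpow_mul, one_div_mul_cancel hp0.ne', one_div_mul_cancel hq0.ne',
      ENNReal.rpow_one] at hH
    calc _ ≤ ((∫⁻ y, K x y * φ y ∂μ) ^ (1 / q) *
          (∫⁻ y, K x y * (φ y ^ (-(p - 1)) * f y ^ p) ∂μ) ^ (1 / p)) ^ p :=
          ENNReal.rpow_le_rpow hH hp0.le
      _ = (∫⁻ y, K x y * φ y ∂μ) ^ (p - 1) *
          ∫⁻ y, K x y * (φ y ^ (-(p - 1)) * f y ^ p) ∂μ := by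
          rw [ENNReal.mul_rpow_of_nonneg _ _ hp0.le, ← ENNReal.rpow_mul, ← ENNReal.rpow_mul, hpq1,
            one_div_mul_cancel hp0.ne', ENNReal.rpow_one]
      _ ≤ (A * φ x) ^ (p - 1) * ∫⁻ y, K x y * (φ y ^ (-(p - 1)) * f y ^ p) ∂μ := by gcongr
      _ = _ := by
          rw [ENNReal.mul_rpow_of_nonneg _ _ hp1.le, mul_assoc, lintegral_const_mul]
          exact (hKx x).mul ((hφ.pow_const _).mul (hf.pow_const _))
  refine (lintegral_mono_ae hpoint).trans ?_
  have hmeas : Measurable fun w : α × α ↦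
      φ w.1 ^ (p - 1) * (K w.1 w.2 * (φ w.2 ^ (-(p - 1)) * f w.2 ^ p)) :=
    ((hφ.comp measurable_fst).pow_const _).mul (hK.mul
      (((hφ.comp measurable_snd).pow_const _).mul ((hf.comp measurable_snd).pow_const _)))
  rw [lintegral_const_mul _ hmeas.lintegral_prod_right',
    lintegral_lintegral_swap hmeas.aemeasurable,
    mul_assoc, ← lintegral_const_mul _ (hf.pow_const p)]
  refine mul_le_mul' le_rfl (lintegral_mono_ae ?_)
  filter_upwards [h₂, hφ0, hφt] with y hy hy0 hyt
  calc ∫⁻ x, φ x ^ (p - 1) * (K x y * (φ y ^ (-(p - 1)) * f y ^ p)) ∂μ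
      = (∫⁻ x, K x y * φ x ^ (p - 1) ∂μ) * (φ y ^ (-(p - 1)) * f y ^ p) := by
        rw [← lintegral_mul_const]
        · exact lintegral_congr fun x ↦ by ring
        · exact (hK.comp (measurable_id.prodMk measurable_const)).mul (hφ.pow_const _)
    _ ≤ (B * φ y ^ (p - 1)) * (φ y ^ (-(p - 1)) * f y ^ p) := by gcongr
    _ = B * (φ y ^ (p - 1) * φ y ^ (-(p - 1))) * f y ^ p := by ring
    _ = B * f y ^ p := by
        rw [← ENNReal.rpow_add _ _ hy0 hyt, add_neg_cancel, ENNReal.rpow_zero, mul_one]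

/-- Weighted fractional integration. -/
theorem exists_lintegral_riesz_rpow_le (hn : 2 ≤ n) {p a α β γ : ℝ} (hp : 1 < p)
    (ha : 0 < a) (hab : a = α + β) (h1 : a < β + γ) (h2 : β + γ < n)
    (h3 : a < α + γ * (p - 1)) (h4 : α + γ * (p - 1) < n) :
    ∃ C : ℝ≥0∞, C < ∞ ∧ ∀ f : Rn n → ℝ≥0∞, Measurable f →
      ∫⁻ x, (∫⁻ y, pw (-α) x * pw (a - n) (x - y) * pw (-β) y * f y) ^ p ≤
        C * ∫⁻ y, f y ^ p := by
  have hp1 : 0 < p - 1 := by linarith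
  obtain ⟨A, hA, hA'⟩ := exists_lintegral_pw_mul_pw_le hn ha h1 h2
  obtain ⟨B, hB, hB'⟩ := exists_lintegral_pw_mul_pw_le hn ha h3 h4
  refine ⟨A ^ (p - 1) * B, ENNReal.mul_lt_top (ENNReal.rpow_lt_top_of_nonneg hp1.le hA.ne) hB,
    fun f hf ↦ ?_⟩
  have hm : ∀ r : ℝ, Measurable (pw r : Rn n → ℝ≥0∞) := measurable_pw
  -- Since a = α + β, the kernel is homogeneous of degree -n, so both Schur integrals reproduce the
  -- weight |x|^{-γ}. The four inequalities on the exponents are their convergence conditions.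
  refine lintegral_rpow_le_of_schur (Real.HolderConjugate.conjExponent hp)
    (K := fun x y ↦ pw (-α) x * pw (a - n) (x - y) * pw (-β) y) (φ := pw (-γ)) ?_ (hm _) ?_ ?_ ?_
    ?_ hf
  · exact (((hm _).comp measurable_fst).mul ((hm _).comp (measurable_fst.sub measurable_snd))).mul
      ((hm _).comp measurable_snd)
  · filter_upwards [ae_ne hn 0] with x hx using pw_ne_zero hx
  · exact Filter.Eventually.of_forall fun x ↦ pw_ne_top _ _
  · filter_upwards [ae_ne hn 0] with x hx
    calc _ = ∫⁻ y, pw (-α) x * (pw (a - n) (x - y) * pw (-(β + γ)) y) := by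
          refine lintegral_congr_ae ?_
          filter_upwards [ae_ne hn 0] with y hy
          rw [neg_add, ← pw_mul_pw hy]
          ring
      _ = pw (-α) x * ∫⁻ y, pw (a - n) (x - y) * pw (-(β + γ)) y :=
          lintegral_const_mul' _ _ (pw_ne_top _ _)
      _ ≤ pw (-α) x * (A * pw (a - (β + γ)) x) := by
          gcongr
          exact hA' x hx
      _ = A * pw (-γ) x := by
          rw [mul_left_comm, pw_mul_pw hx]
          congr 2
          rw [hab]
          ring
  · filter_upwards [ae_ne hn 0] with y hy
    simp only [pw_rpow hp1.le]
    calc _ = ∫⁻ x, pw (-β) y * (pw (a - n) (y - x) * pw (-(α + γ * (p - 1))) x) := by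
          refine lintegral_congr_ae ?_
          filter_upwards [ae_ne hn 0] with x hx
          have : -(α + γ * (p - 1)) = -α + -γ * (p - 1) := by ring
          rw [this, ← pw_mul_pw hx, pw_sub_comm]
          ring
      _ = pw (-β) y * ∫⁻ x, pw (a - n) (y - x) * pw (-(α + γ * (p - 1))) x :=
          lintegral_const_mul' _ _ (pw_ne_top _ _)
      _ ≤ pw (-β) y * (B * pw (a - (α + γ * (p - 1))) y) := by
          gcongr
          exact hB' y hy
      _ = B * pw (-γ * (p - 1)) y := by
          rw [mul_left_comm, pw_mul_pw hy]
          congr 2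
          rw [hab]
          ring

/-- The Hardy inequality for Riesz potentials. -/
theorem exists_hardy (hn : 2 ≤ n) {p s : ℝ} (hp : 1 < p) (hs : 0 < s) (hsp : s * p < n) :
    ∃ C : ℝ≥0∞, C < ∞ ∧ ∀ f : Rn n → ℝ≥0∞, Measurable f →
      ∫⁻ x, (pw (-s) x * ∫⁻ y, pw (s - n) (x - y) * f y) ^ p ≤ C * ∫⁻ y, f y ^ p := by
  have hp1 : 0 < p - 1 := by linarith
  -- The range of admissible weights is nonempty because sp < n.
  obtain ⟨γ, hγ1, hγ2⟩ := exists_between (show s < min (n : ℝ) ((n - s) / (p - 1)) by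
    rw [lt_min_iff, lt_div_iff₀ hp1]
    constructor <;> nlinarith)
  rw [lt_min_iff, lt_div_iff₀ hp1] at hγ2
  obtain ⟨C, hC, h⟩ := exists_lintegral_riesz_rpow_le hn (a := s) (α := s) (β := 0) (γ := γ) hp hs
    (by ring) (by linarith) (by linarith [hγ2.1]) (by nlinarith) (by linarith [hγ2.2])
  refine ⟨C, hC, fun f hf ↦ (le_of_eq ?_).trans (h f hf)⟩
  refine lintegral_congr fun x ↦ ?_
  rw [← lintegral_const_mul' _ _ (pw_ne_top _ _)]
  congr 1
  refine lintegral_congr fun y ↦ ?_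
  simp only [pw, neg_zero, Real.rpow_zero, ENNReal.ofReal_one, mul_one]
  ring

/-- The dual Hardy inequality for Riesz potentials. -/
theorem exists_dual_hardy (hn : 2 ≤ n) {p b : ℝ} (hp : 1 < p) (hb : 0 < b)
    (hbp : b * p < n * (p - 1)) :
    ∃ C : ℝ≥0∞, C < ∞ ∧ ∀ f : Rn n → ℝ≥0∞, Measurable f →
      ∫⁻ x, (∫⁻ y, pw (b - n) (x - y) * (pw (-b) y * f y)) ^ p ≤ C * ∫⁻ y, f y ^ p := by
  have hp1 : 0 < p - 1 := by linarith
  have hn0 : (2 : ℝ) ≤ n := by exact_mod_cast hn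
  have hbn : b < n := by
    by_contra h
    nlinarith
  -- Here bp < n(p-1) is what puts b/(p-1) below n - b.
  obtain ⟨γ, hγ1, hγ2⟩ := exists_between (show b / (p - 1) < min ((n : ℝ) - b) (n / (p - 1)) by
    rw [lt_min_iff, div_lt_iff₀ hp1, div_lt_div_iff_of_pos_right hp1]
    constructor <;> nlinarith)
  rw [div_lt_iff₀ hp1] at hγ1
  rw [lt_min_iff, lt_div_iff₀ hp1] at hγ2
  have hγ0 : 0 < γ := by
    by_contra h
    nlinarith
  obtain ⟨C, hC, h⟩ := exists_lintegral_riesz_rpow_le hn (a := b) (α := 0) (β := b) (γ := γ) hp hb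
    (by ring) (by linarith) (by linarith [hγ2.1]) (by linarith) (by linarith [hγ2.2])
  refine ⟨C, hC, fun f hf ↦ (le_of_eq ?_).trans (h f hf)⟩
  refine lintegral_congr fun x ↦ ?_
  congr 1
  refine lintegral_congr fun y ↦ ?_
  simp only [pw, neg_zero, Real.rpow_zero, ENNReal.ofReal_one, one_mul]
  ring

/-! ### The commutator estimate and its two consequences -/

/-- The commutator of `(1 + |D|²)^{s/2}` with a function that is Lipschitz relative to the
distance to the origin. -/
theorem exists_eLpNorm_commutator_le (hn : 2 ≤ n) {s : ℝ} (hs : 0 < s) (hs1 : s < 1) {p : ℝ≥0∞}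
    (hp : 2 < p) (hp' : p ≠ ∞) (hsp : s * p.toReal < n) :
    ∃ C : ℝ≥0∞, C < ∞ ∧ ∀ (g : Rn n → ℂ) (u w : 𝓢(Rn n, ℂ)), Measurable g →
      (∀ y, w y = g y * u y) → ∀ L : ℝ≥0∞, L ≠ ∞ → (∀ x y, y ≠ 0 →
        ‖(g x - g y) * u y‖ₑ ≤ L * pw 1 (x - y) * pw (-1) y * ‖u y‖ₑ) →
      eLpNorm (fun x ↦ japS n s w x - g x * japS n s u x) p volume ≤ C * L * sN s p u := by
  have hn2 : (2 : ℝ) ≤ n := by exact_mod_cast hn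
  have hr : 2 < p.toReal := by
    rw [← ENNReal.toReal_ofNat]
    exact (ENNReal.toReal_lt_toReal (by simp) hp').2 hp
  have hp0 : p ≠ 0 := (zero_lt_two.trans hp).ne'
  set r := p.toReal with hrdef
  have hr0 : 0 < r := by linarith
  obtain ⟨C₁, hC₁, h₁⟩ := exists_enorm_commutator_le hn hs (by linarith)
  obtain ⟨C₂, hC₂, h₂⟩ := exists_enorm_japS_neg_le hn hs (by linarith)
  obtain ⟨C₃, hC₃, h₃⟩ := exists_hardy hn (by linarith) hs hsp
  obtain ⟨C₄, hC₄, h₄⟩ := exists_dual_hardy hn (p := r) (b := 1 - s) (by linarith) (by linarith)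
    (by nlinarith)
  have hinv : 0 ≤ 1 / r := by positivity
  refine ⟨C₁ * C₂ * (C₃ ^ (1 / r) * C₄ ^ (1 / r)), ENNReal.mul_lt_top (ENNReal.mul_lt_top hC₁ hC₂)
    (ENNReal.mul_lt_top (ENNReal.rpow_lt_top_of_nonneg hinv hC₃.ne)
      (ENNReal.rpow_lt_top_of_nonneg hinv hC₄.ne)), fun g u w hg hw L hL hgL ↦ ?_⟩
  -- The increment of g improves the kernel to |x-y|^{1-s-n}. The weight |y|^{-1} is split as
  -- |y|^{-(1-s)} |y|^{-s}: the first factor is for the dual Hardy inequality, the second for the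
  -- Hardy inequality applied to u as a Bessel potential of J^s u.
  have hpt : ∀ x, ‖japS n s w x - g x * japS n s u x‖ₑ ≤ C₁ * L *
      ∫⁻ y, pw (1 - s - n) (x - y) * (pw (-(1 - s)) y * (pw (-s) y * ‖u y‖ₑ)) := by
    intro x
    refine (h₁ g u w hg hw x).trans ?_
    rw [mul_assoc, ← lintegral_const_mul' _ _ hL]
    refine mul_le_mul' le_rfl (lintegral_mono_ae ?_)
    filter_upwards [ae_ne hn 0, ae_ne hn x] with y hy hyx
    calc _ ≤ pw (-s - n) (x - y) * (L * pw 1 (x - y) * pw (-1) y * ‖u y‖ₑ) := by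
          gcongr
          exact hgL x y hy
      _ = L * ((pw 1 (x - y) * pw (-s - n) (x - y)) * (pw (-1) y * ‖u y‖ₑ)) := by ring
      _ = _ := by
          rw [pw_mul_pw (sub_ne_zero.2 hyx.symm), ← mul_assoc (pw (-(1 - s)) y), pw_mul_pw hy,
            show 1 + (-s - (n : ℝ)) = 1 - s - n by ring, show -(1 - s) + -s = (-1 : ℝ) by ring]
  have hu : ∀ y, ‖u y‖ₑ ≤ C₂ * ∫⁻ z, pw (s - n) (y - z) * ‖japS n s u z‖ₑ := by
    intro y
    conv_lhs => rw [← japS_neg_japS s u]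
    exact h₂ _ y
  have hmu : Measurable fun y ↦ pw (-s) y * ‖u y‖ₑ :=
    (measurable_pw _).mul u.continuous.measurable.enorm
  have hmJ : Measurable fun y ↦ ‖japS n s u y‖ₑ := (japS n s u).continuous.measurable.enorm
  have hI1 : ∫⁻ y, (pw (-s) y * ‖u y‖ₑ) ^ r ≤ C₂ ^ r * (C₃ * ∫⁻ z, ‖japS n s u z‖ₑ ^ r) := by
    calc _ ≤ ∫⁻ y, C₂ ^ r * (pw (-s) y * ∫⁻ z, pw (s - n) (y - z) * ‖japS n s u z‖ₑ) ^ r := by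
          refine lintegral_mono fun y ↦ ?_
          simp only
          rw [← ENNReal.mul_rpow_of_nonneg _ _ hr0.le, mul_left_comm]
          gcongr
          exact hu y
      _ = C₂ ^ r * ∫⁻ y, (pw (-s) y * ∫⁻ z, pw (s - n) (y - z) * ‖japS n s u z‖ₑ) ^ r :=
          lintegral_const_mul' _ _ (ENNReal.rpow_ne_top_of_nonneg hr0.le hC₂.ne)
      _ ≤ _ := by
          gcongr
          exact h₃ _ hmJ
  have hI2 : ∫⁻ x, ‖japS n s w x - g x * japS n s u x‖ₑ ^ r ≤
      (C₁ * L) ^ r * (C₄ * (C₂ ^ r * (C₃ * ∫⁻ z, ‖japS n s u z‖ₑ ^ r))) := by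
    calc _ ≤ ∫⁻ x, (C₁ * L) ^ r * (∫⁻ y, pw (1 - s - n) (x - y) *
          (pw (-(1 - s)) y * (pw (-s) y * ‖u y‖ₑ))) ^ r := by
          refine lintegral_mono fun x ↦ ?_
          simp only
          rw [← ENNReal.mul_rpow_of_nonneg _ _ hr0.le]
          gcongr
          exact hpt x
      _ = (C₁ * L) ^ r * ∫⁻ x, (∫⁻ y, pw (1 - s - n) (x - y) *
          (pw (-(1 - s)) y * (pw (-s) y * ‖u y‖ₑ))) ^ r :=
          lintegral_const_mul' _ _ (ENNReal.rpow_ne_top_of_nonneg hr0.le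
            (ENNReal.mul_ne_top hC₁.ne hL))
      _ ≤ _ := by
          gcongr
          exact (h₄ _ hmu).trans (by gcongr)
  rw [sN, eLpNorm_eq_lintegral_rpow_enorm_toReal hp0 hp',
    eLpNorm_eq_lintegral_rpow_enorm_toReal hp0 hp', ← hrdef]
  have hroot : ∀ z : ℝ≥0∞, (z ^ r) ^ (1 / r) = z := fun z ↦ by
    rw [← ENNReal.rpow_mul, mul_one_div_cancel hr0.ne', ENNReal.rpow_one]
  calc _ ≤ ((C₁ * L) ^ r * (C₄ * (C₂ ^ r * (C₃ * ∫⁻ z, ‖japS n s u z‖ₑ ^ r)))) ^ (1 / r) :=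
        ENNReal.rpow_le_rpow hI2 hinv
    _ = C₁ * L * (C₄ ^ (1 / r) * (C₂ * (C₃ ^ (1 / r) *
        (∫⁻ z, ‖japS n s u z‖ₑ ^ r) ^ (1 / r)))) := by
        simp only [ENNReal.mul_rpow_of_nonneg _ _ hinv, hroot]
    _ = _ := by ring

/-- The bound is uniform in ρ. For |y| ≤ 4ρ the Lipschitz constant K/ρ is at most 4K/|y|. For |y| >
4ρ the cutoff vanishes at y, and it is nonzero at x only if |x| < 2ρ < |y|/2, so that |x-y| ≥ |y|/2.
-/
theorem exists_norm_cutoffAt_sub_le (n : ℕ) :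
    ∃ K : ℝ, 0 ≤ K ∧ ∀ (ρ : ℝ) (hρ : 0 < ρ) (x y : Rn n), y ≠ 0 →
      ‖cutoffAt n hρ x - cutoffAt n hρ y‖ ≤ K * ‖x - y‖ * ‖y‖⁻¹ := by
  obtain ⟨K, hK⟩ := (bump n).contDiff (n := 1) |>.lipschitzWith_of_hasCompactSupport
    (bump n).hasCompactSupport one_ne_zero
  refine ⟨max (4 * K) 2, by positivity, fun ρ hρ x y hy ↦ ?_⟩
  have hy0 : 0 < ‖y‖ := norm_pos_iff.2 hy
  rw [← div_eq_mul_inv, le_div_iff₀ hy0]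
  rcases le_or_gt ‖y‖ (4 * ρ) with h | h
  · have h1 : ‖cutoffAt n hρ x - cutoffAt n hρ y‖ ≤ K * (ρ⁻¹ * ‖x - y‖) := by
      rw [cutoffAt_apply, cutoffAt_apply, ← Complex.ofReal_sub, Complex.norm_real, ← dist_eq_norm]
      refine (hK.dist_le_mul _ _).trans_eq ?_
      rw [dist_eq_norm, ← smul_sub, norm_smul, norm_inv, Real.norm_of_nonneg hρ.le]
    calc _ ≤ K * (ρ⁻¹ * ‖x - y‖) * (4 * ρ) := by gcongr
      _ = 4 * K * ‖x - y‖ := by field_simp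
      _ ≤ _ := by gcongr; exact le_max_left _ _
  · rw [cutoffAt_eq_zero hρ (by linarith : 2 * ρ ≤ ‖y‖), sub_zero]
    rcases le_or_gt (2 * ρ) ‖x‖ with hx | hx
    · rw [cutoffAt_eq_zero hρ hx, norm_zero, zero_mul]
      positivity
    · have h2 : ‖y‖ ≤ 2 * ‖x - y‖ := by
        have := norm_sub_norm_le y x
        rw [norm_sub_rev] at this
        linarith
      calc _ ≤ 1 * (2 * ‖x - y‖) := by
            gcongr
            exact norm_cutoffAt_le hρ x
        _ = 2 * ‖x - y‖ := one_mul _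
        _ ≤ _ := by gcongr; exact le_max_right _ _

theorem enorm_mul_le_of_norm_le {z : ℂ} {K : ℝ} (hK : 0 ≤ K) {x y : Rn n} (c : ℂ)
    (h : ‖z‖ ≤ K * ‖x - y‖ * ‖y‖⁻¹) :
    ‖z * c‖ₑ ≤ ENNReal.ofReal K * pw 1 (x - y) * pw (-1) y * ‖c‖ₑ := by
  rw [enorm_mul, pw, pw, Real.rpow_one, Real.rpow_neg_one, ← ENNReal.ofReal_mul hK,
    ← ENNReal.ofReal_mul (by positivity), ← ofReal_norm z]
  gcongr

theorem eLpNorm_cutoffAt_mul_le {ρ : ℝ} (hρ : 0 < ρ) (p : ℝ≥0∞) (f : Rn n → ℂ) :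
    eLpNorm (fun x ↦ cutoffAt n hρ x * f x) p volume ≤ eLpNorm f p volume := by
  refine eLpNorm_mono fun x ↦ ?_
  rw [norm_mul]
  exact mul_le_of_le_one_left (norm_nonneg _) (norm_cutoffAt_le hρ x)

/-- J^s(χu) is χJ^s u plus a commutator, whose constant does not depend on the scale of χ. -/
theorem uniformCutoffs_of_pos (hn : 2 ≤ n) {s : ℝ} (hs : 0 < s) (hs1 : s < 1) {p : ℝ≥0∞}
    (hp : 2 < p) (hp' : p ≠ ∞) (hsp : s * p.toReal < n) : UniformCutoffs n s p := by
  obtain ⟨C, hC, h⟩ := exists_eLpNorm_commutator_le hn hs hs1 hp hp' hsp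
  obtain ⟨K, hK, hKle⟩ := exists_norm_cutoffAt_sub_le n
  have hp1 : 1 ≤ p := one_le_two.trans hp.le
  refine ⟨C * ENNReal.ofReal K + 1, ENNReal.add_lt_top.2 ⟨ENNReal.mul_lt_top hC
    ENNReal.ofReal_lt_top, ENNReal.one_lt_top⟩, fun ρ hρ ↦ ⟨cutoffAt n hρ, fun x hx ↦
    cutoffAt_eq_one hρ (mem_ball_zero_iff.1 hx).le, tsupport_cutoffAt hρ, fun u ↦ ?_⟩⟩
  set χ := cutoffAt n hρ with hχ
  set w := (χ.mulCLM u).toSchwartz with hw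
  have hcomm := h χ u w χ.continuous.measurable (fun y ↦ rfl) (ENNReal.ofReal K)
    ENNReal.ofReal_ne_top (fun x y hy ↦ enorm_mul_le_of_norm_le hK _ (hKle ρ hρ x y hy))
  have e : (japS n s w : Rn n → ℂ) = (fun x ↦ japS n s w x - χ x * japS n s u x) +
      fun x ↦ χ x * japS n s u x := by
    ext x
    simp
  have hm : Continuous fun x ↦ χ x * japS n s u x := χ.continuous.mul (japS n s u).continuous
  rw [sN, e]
  refine (eLpNorm_add_le ((japS n s w).continuous.sub hm).aestronglyMeasurable
    hm.aestronglyMeasurable hp1).trans ?_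
  rw [add_mul, one_mul]
  exact add_le_add hcomm (eLpNorm_cutoffAt_mul_le hρ p _)

/-- Let χ be 1 near the support of u and 0 outside B(0, ρ). Then u = χu, and off that ball J^s u
equals the commutator J^s(χu) - χJ^s u. For y in the support of u, χ(x) differs from χ(y) only if
|x-y| ≥ ρ/4, while |y| < r; hence L is of order r/ρ, which is as small as desired. -/
theorem concentrates_of_pos (hn : 2 ≤ n) {s : ℝ} (hs : 0 < s) (hs1 : s < 1) {p : ℝ≥0∞}
    (hp : 2 < p) (hp' : p ≠ ∞) (hsp : s * p.toReal < n) : Concentrates n s p := by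
  obtain ⟨C, hC, h⟩ := exists_eLpNorm_commutator_le hn hs hs1 hp hp' hsp
  intro ρ hρ τ hτ
  have hlim : Filter.Tendsto (fun r : ℝ ↦ C * ENNReal.ofReal (2 * (4 * r / ρ))) (𝓝[>] 0) (𝓝 0) := by
    have h1 : Continuous fun r : ℝ ↦ ENNReal.ofReal (2 * (4 * r / ρ)) :=
      ENNReal.continuous_ofReal.comp (by fun_prop)
    have h2 := (h1.tendsto 0).mono_left (nhdsWithin_le_nhds (s := Set.Ioi (0 : ℝ)))
    have h3 := ENNReal.Tendsto.const_mul (a := C) h2 (Or.inr hC.ne)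
    simpa using h3
  obtain ⟨r, hrτ, hr⟩ := ((hlim.eventually (Iic_mem_nhds (ENNReal.ofReal_pos.2 hτ))).and
    (Ioo_mem_nhdsGT (show 0 < ρ / 4 by positivity))).exists
  have hr0 : 0 < r := hr.1
  refine ⟨r, hr0, fun u hu ↦ ?_⟩
  have hρ2 : 0 < ρ / 2 := by positivity
  set χ := cutoffAt n hρ2 with hχ
  have husupp : ∀ y, u y ≠ 0 → ‖y‖ < r := fun y hy ↦
    mem_ball_zero_iff.1 (hu (subset_tsupport _ hy))
  have hone : ∀ y, u y ≠ 0 → χ y = 1 := fun y hy ↦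
    cutoffAt_eq_one hρ2 (by linarith [husupp y hy, hr.2])
  have hcomm := h χ u.toSchwartz u.toSchwartz χ.continuous.measurable (fun y ↦ ?_)
    (ENNReal.ofReal (2 * (4 * r / ρ))) ENNReal.ofReal_ne_top (fun x y hy ↦ ?_)
  · calc _ ≤ eLpNorm (fun x ↦ japS n s u.toSchwartz x - χ x * japS n s u.toSchwartz x) p
          volume := by
          refine eLpNorm_mono fun x ↦ ?_
          by_cases hx : x ∈ Metric.ball (0 : Rn n) ρ
          · rw [Set.indicator_of_notMem (by simpa using hx), norm_zero]
            positivity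
          · have hx' : ρ ≤ ‖x‖ := by simpa using hx
            rw [Set.indicator_of_mem (by simpa using hx'),
              cutoffAt_eq_zero hρ2 (by linarith : 2 * (ρ / 2) ≤ ‖x‖), zero_mul, sub_zero]
      _ ≤ C * ENNReal.ofReal (2 * (4 * r / ρ)) * sN s p u.toSchwartz := hcomm
      _ ≤ _ := by
          gcongr
  · by_cases hy : u y = 0
    · simp [Test.toSchwartz_apply, hy]
    · rw [hone y hy, one_mul]
  · rw [Test.toSchwartz_apply]
    by_cases huy : u y = 0
    · simp [huy]
    · refine enorm_mul_le_of_norm_le (by positivity) _ ?_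
      rw [hone y huy]
      have hy0 : 0 < ‖y‖ := norm_pos_iff.2 hy
      have hyr := husupp y huy
      rcases le_or_gt ‖x‖ (ρ / 2) with hx | hx
      · rw [cutoffAt_eq_one hρ2 hx, sub_self, norm_zero]
        positivity
      · have h1 : ‖χ x - 1‖ ≤ 2 := by
          refine (norm_sub_le _ _).trans ?_
          have := norm_cutoffAt_le hρ2 x
          rw [norm_one]
          linarith
        have h2 : ρ / 4 ≤ ‖x - y‖ := by
          have := norm_sub_norm_le x y
          linarith [hr.2]
        refine h1.trans ?_
        rw [← div_eq_mul_inv, le_div_iff₀ hy0]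
        calc 2 * ‖y‖ ≤ 2 * r := by gcongr
          _ = 2 * (4 * r / ρ) * (ρ / 4) := by field_simp
          _ ≤ _ := by gcongr

/-! ### The case s = 0, the exponents, and the conclusion -/

theorem uniformCutoffs_zero (p : ℝ≥0∞) : UniformCutoffs n 0 p := by
  refine ⟨1, ENNReal.one_lt_top, fun ρ hρ ↦ ⟨cutoffAt n hρ, fun x hx ↦
    cutoffAt_eq_one hρ (mem_ball_zero_iff.1 hx).le, tsupport_cutoffAt hρ, fun u ↦ ?_⟩⟩
  rw [sN, sN, japS_zero, japS_zero, one_mul]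
  exact eLpNorm_cutoffAt_mul_le hρ p u

theorem concentrates_zero (p : ℝ≥0∞) : Concentrates n 0 p := by
  intro ρ hρ τ hτ
  refine ⟨ρ, hρ, fun u hu ↦ ?_⟩
  have : (Metric.ball (0 : Rn n) ρ)ᶜ.indicator (japS n 0 u.toSchwartz) = 0 := by
    ext x
    by_cases hx : x ∈ Metric.ball (0 : Rn n) ρ
    · rw [Set.indicator_of_notMem (by simpa using hx), Pi.zero_apply]
    · rw [Set.indicator_of_mem hx, japS_zero, Test.toSchwartz_apply, Pi.zero_apply]
      exact image_eq_zero_of_notMem_tsupport fun h ↦ hx (hu h)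
  rw [this, eLpNorm_zero]
  exact zero_le

theorem two_lt_expP (hn : 2 ≤ n) : 2 < expP n := by
  have hn2 : (2 : ℝ) ≤ n := by exact_mod_cast hn
  rw [expP, ← ENNReal.ofReal_ofNat, ENNReal.ofReal_lt_ofReal_iff_of_nonneg (by norm_num),
    lt_div_iff₀ (by linarith)]
  linarith

theorem expS_lt_one (hn : 2 ≤ n) {ε : ℝ} (hε : 0 < ε) : expS n ε < 1 := by
  have hn2 : (2 : ℝ) ≤ n := by exact_mod_cast hn
  unfold expS
  split_ifs
  · linarith
  · rw [div_lt_one (by linarith)]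
    linarith

/-- For n = 2 the product is 2 - 6ε, so ε > 0 is exactly what avoids the endpoint of Hardy's
inequality; for n ≥ 3 it is 2/(n-1). -/
theorem expS_mul_expP_lt (hn : 2 ≤ n) {ε : ℝ} (hε : 0 < ε) :
    expS n ε * (expP n).toReal < n := by
  have hn2 : (2 : ℝ) ≤ n := by exact_mod_cast hn
  rw [expP, ENNReal.toReal_ofReal (div_nonneg (by linarith) (by linarith)), ← mul_div_assoc,
    div_lt_iff₀ (by linarith)]
  unfold expS
  split_ifs with h
  · subst h
    norm_num
    linarith
  · have h3 : (3 : ℝ) ≤ n := by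
      have : 3 ≤ n := by omega
      exact_mod_cast this
    rw [mul_left_comm, one_div_mul_cancel (by linarith)]
    nlinarith

theorem normX_zero (ε : ℝ) : normX ε (0 : Distr n) = 0 := by
  refine le_antisymm (iSup₂_le fun u _ ↦ ?_) zero_le
  have h : sobolevNorm (-expS n ε) (expQ n) ((0 : Distr n).mulTest u) = 0 := by
    have h0 : (0 : Distr n).mulTest u = 0 := rfl
    refine le_antisymm ?_ zero_le
    rw [h0]
    refine iInf_le_of_le 0 (iInf_le_of_le MemLp.zero (iInf_le_of_le (fun φ ↦ ?_) ?_))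
    · simp
    · simp
  rw [h, ENNReal.zero_div]

theorem tendsto_normXOn_ball (hn : 2 ≤ n) {ε : ℝ} (hε : 0 < ε) {W : Distr n} (hW : MemX ε W) :
    Filter.Tendsto (fun α : ℝ ↦ normXOn ε (Metric.ball (0 : Rn n) α) W) (𝓝[>] 0) (𝓝 0) := by
  have hp := two_lt_expP hn
  have hp' := expP_ne_top (n := n)
  -- Nonpositive s occurs only for n = 2 and ε ≥ 1/3.
  rcases lt_trichotomy (expS n ε) 0 with hs | hs | hs
  · obtain ⟨M, hM, hb⟩ := hW.exists_bound hn
    obtain rfl := eq_zero_of_neg hn hs hp hp' hM hb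
    have h0 : ∀ α : ℝ, normXOn ε (Metric.ball (0 : Rn n) α) 0 = 0 := fun α ↦
      le_antisymm (iInf_le_of_le 0 (iInf_le_of_le hW (iInf_le_of_le (fun _ _ ↦ rfl)
        (normX_zero ε).le))) zero_le
    simp only [h0]
    exact tendsto_const_nhds
  · exact tendsto_normXOn hn (by rw [hs]; exact uniformCutoffs_zero _)
      (by rw [hs]; exact concentrates_zero _) hW
  · exact tendsto_normXOn hn
      (uniformCutoffs_of_pos hn hs (expS_lt_one hn hε) hp hp' (expS_mul_expP_lt hn hε))
      (concentrates_of_pos hn hs (expS_lt_one hn hε) hp hp' (expS_mul_expP_lt hn hε)) hW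

end KochTataru

end

theorem mainTheorem10 (n : ℕ) (hn : 2 ≤ n) (ε : ℝ) (hε : 0 < ε)
    (W : KochTataru.Distr n) (hW : KochTataru.MemX ε W) :
    Filter.Tendsto
      (fun α : ℝ ↦ KochTataru.normXOn ε (Metric.ball (0 : KochTataru.Rn n) α) W)
      (𝓝[>] 0) (𝓝 0) := by
  exact KochTataru.tendsto_normXOn_ball hn hε hW
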